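/- A group is $\mathbb{Z}$-linear if it has a faithful representation into $GL_n(\mathbb{Z})$ for some $n$. A right-angled Artin group (RAAG) is a group $K$ that has a finite generating set $S$ such that $K=\langle S\mid R\rangle$, where $R$ consists of commutators $[s,s']$ of certain pairs of elements of $S$; every such $S$ is called a RAAG generating set of $K$. Let $m\ge 0$, and let $S_m$ be the star graph with one central vertex and $m$ external vertices, the $i$-th of which is joined to the central vertex by a single edge $e_i$. Let $(\mathcal{G},S_m)$ be a graph of groups on $S_m$ such that the group of the central vertex is a free group of finite rank, the groups of the external vertices are right-angled Artin groups, and each edge group $G_{e_i}=\langle k_i\rangle$ is cyclic. For each $i$ let $\alpha_{e_i}$ and $\omega_{e_i}$ be the monomorphisms from $G_{e_i}$ to the central vertex group and to the $i$-th external vertex group, respectively. Assume that for every $i=1,\dots,m$ the element $\omega_{e_i}(k_i)$ belongs to some RAAG generating set of the $i$-th external vertex group. Then the fundamental group $\pi_1(\mathcal{G},S_m)$ of the graph of groups is $\mathbb{Z}$-linear. -/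

import Mathlib

/-- A group `G` is linear over the commutative ring `K` if it has a faithful representation
`G → GL_n(K)` for some `n`. -/
def IsLinearOver (K : Type*) [CommRing K] (G : Type*) [Group G] : Prop :=
  ∃ (n : ℕ) (ρ : G →* Matrix.GeneralLinearGroup (Fin n) K), Function.Injective ρ

/-- The right-angled Artin group of a simple graph `Γ`: generated by the vertices of `Γ`, with
the commutators of adjacent vertices as relators. -/
abbrev RAAG {S : Type*} (Γ : SimpleGraph S) : Type _ :=
  PresentedGroup {r : FreeGroup S | ∃ u v : S, Γ.Adj u v ∧
      r = FreeGroup.of u * FreeGroup.of v * (FreeGroup.of u)⁻¹ * (FreeGroup.of v)⁻¹}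

/-- `S` is a RAAG generating set of `K`: it is finite, and `K` is a right-angled Artin group with
`S` as its standard generating set, that is, `K` is presented by the generators `S` and the
commutators of certain pairs of elements of `S`. -/
def IsRAAGGeneratingSet {K : Type*} [Group K] (S : Set K) : Prop :=
  S.Finite ∧ ∃ (Γ : SimpleGraph S) (φ : RAAG Γ ≃* K), ∀ s : S, φ (PresentedGroup.of s) = s

/-- A graph with vertex set `V` and with oriented edges `E × Bool`. An element of `E` is a pair of
mutually inverse oriented edges: `(e, true)` runs from `src e` to `tgt e`, and `(e, false)` is its
inverse. Loops and multiple edges are allowed. -/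
structure GGraph (V E : Type*) where
  src : E → V
  tgt : E → V

namespace GGraph

/-- The inverse `ē` of an oriented edge. -/
def bar {E : Type*} (e : E × Bool) : E × Bool := (e.1, !e.2)

variable {V E : Type*} (Γ : GGraph V E)

/-- The initial vertex `α(e)` of an oriented edge. -/
def init : E × Bool → V
  | (e, true) => Γ.src e
  | (e, false) => Γ.tgt e

/-- The terminal vertex `ω(e) = α(ē)` of an oriented edge. -/
def term (e : E × Bool) : V := Γ.init (bar e)

/-- `Γ.IsPath u v p`: the edges in the list `p` form a path from `u` to `v`. -/
def IsPath : V → V → List (E × Bool) → Prop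
  | u, v, [] => u = v
  | u, v, e :: p => Γ.init e = u ∧ IsPath (Γ.term e) v p

/-- The graph is nonempty and any two vertices are joined by a path. -/
def Connected : Prop := Nonempty V ∧ ∀ u v : V, ∃ p, Γ.IsPath u v p

/-- A path is reduced if no edge in it is followed by its inverse. -/
def IsReduced {E : Type*} (p : List (E × Bool)) : Prop := p.IsChain fun e e' => e' ≠ bar e

/-- The edges in `T` (together with their inverses) and all the vertices form a tree, that is, any
two vertices are joined by exactly one reduced path whose edges are in `T`. In a connected graph
these are exactly the maximal subtrees. -/
def IsMaximalSubtree (T : Set E) : Prop :=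
  ∀ u v : V, ∃! p : List (E × Bool), Γ.IsPath u v p ∧ IsReduced p ∧ ∀ e ∈ p, e.1 ∈ T

end GGraph

/-- The star graph `S_m`: a central vertex `none`, and `m` external vertices `some i`, each joined
to the center by one edge, which is oriented from the center to the external vertex. -/
def starGraph (m : ℕ) : GGraph (Option (Fin m)) (Fin m) where
  src _ := none
  tgt i := some i

/-- A graph of groups on `Γ`. The edge group of an oriented edge `e` is `edgeGroup e.1`, so that
`e` and `ē` have the same edge group. -/
structure GraphOfGroups {V E : Type*} (Γ : GGraph V E) where
  connected : Γ.Connected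
  vertexGroup : V → Type*
  edgeGroup : E → Type*
  [vertexGroupGroup : ∀ v, Group (vertexGroup v)]
  [edgeGroupGroup : ∀ e, Group (edgeGroup e)]
  /-- the monomorphism `α_e : G_e → G_{α(e)}` of an oriented edge `e` -/
  α : ∀ e : E × Bool, edgeGroup e.1 →* vertexGroup (Γ.init e)
  α_injective : ∀ e, Function.Injective (α e)

namespace GraphOfGroups

attribute [instance] vertexGroupGroup edgeGroupGroup

variable {V E : Type*} {Γ : GGraph V E} (𝒢 : GraphOfGroups Γ)

/-- The monomorphism `ω_e = α_ē : G_e → G_{ω(e)}` of an oriented edge `e`. -/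
def ω (e : E × Bool) : 𝒢.edgeGroup e.1 →* 𝒢.vertexGroup (Γ.term e) := 𝒢.α (GGraph.bar e)

/-- The free product of all the vertex groups and of the free group on the symbols `t_e`, where
`e` runs over the oriented edges. -/
abbrev BigFreeProduct : Type _ :=
  Monoid.Coprod (Monoid.CoprodI 𝒢.vertexGroup) (FreeGroup (E × Bool))

/-- An element of a vertex group, in the free product. -/
def vertexElt (v : V) (g : 𝒢.vertexGroup v) : 𝒢.BigFreeProduct :=
  Monoid.Coprod.inl (Monoid.CoprodI.of g)

/-- The symbol `t_e`, in the free product. -/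
def edgeElt (e : E × Bool) : 𝒢.BigFreeProduct := Monoid.Coprod.inr (FreeGroup.of e)

/-- The relators `t_e α_e(g) t_e⁻¹ (α_ē(g))⁻¹` and `t_e t_ē`. -/
def pathRelators : Set 𝒢.BigFreeProduct :=
  {r | ∃ (e : E × Bool) (g : 𝒢.edgeGroup e.1),
      r = 𝒢.edgeElt e * 𝒢.vertexElt (Γ.init e) (𝒢.α e g) * (𝒢.edgeElt e)⁻¹ *
        (𝒢.vertexElt (Γ.term e) (𝒢.ω e g))⁻¹} ∪
  {r | ∃ e : E × Bool, r = 𝒢.edgeElt e * 𝒢.edgeElt (GGraph.bar e)}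

/-- The path group `F(𝒢, Γ)`. -/
abbrev PathGroup : Type _ := 𝒢.BigFreeProduct ⧸ Subgroup.normalClosure 𝒢.pathRelators

/-- The fundamental group `π₁(𝒢, Γ, T)` with respect to a maximal subtree `T`: the quotient of the
path group by the normal closure of the `t_e` with `e` in `T`. -/
abbrev FundamentalGroup (T : Set E) : Type _ :=
  𝒢.PathGroup ⧸ Subgroup.normalClosure
    {x : 𝒢.PathGroup | ∃ e : E × Bool, e.1 ∈ T ∧ x = QuotientGroup.mk (𝒢.edgeElt e)}

end GraphOfGroups

-- Let `F` be the central free group and `w i` the image in `F` of the generator of the `i`-th edge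
-- group. The fundamental group `G` is generated by `F` and the right-angled Artin groups (RAAGs),
-- with `w i` identified with a standard generator `s i`. It embeds into the semidirect product of a
-- RAAG on a finite graph with a finite group of graph symmetries, and such a product is linear over
-- `ℤ`.
--
-- Linearity: each generator acts on `ℤ^(S × Bool)` as a product of two reflections. Ping-pong on
-- the all-ones vector shows that only the identity of the RAAG fixes it
-- (`RAAG.eq_one_of_reflectionRep_one`). Graph symmetries permute coordinates and fix this vector,
-- so the two actions combine to a faithful one (`RAAG.extendedRep_injective`).
--
-- Embedding: up to conjugation `w i` is a cyclically reduced word, read around a cycle with `l i`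
-- vertices. Completing the labels to permutations gives a map `π` from `F` to a finite group `Q`,
-- and `F` embeds into `FreeGroup (Q × X) ⋊ Q` by sending a word to its path in the Cayley graph and
-- the end point. A copy of `S i` is added for each vertex of the `i`-th cycle, and the neighbours
-- of `s i` are made to commute with the edges over the cycle. The word around the cycle then
-- commutes with the copies at `0` of these neighbours, so it can serve as the image of `s i`.
--
-- Injectivity: the RAAG of the cover graph acts on `FreeGroup (Q × X) × G`, and the action recovers
-- an element of `G` from its image. The action is well defined because a word whose path stays over
-- the cycle and closes up there is a power of the cycle word
-- (`FreeGroup.mem_zpowers_of_cayleyPath_mem`).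

namespace RAAG

-- Reduced expressions in right-angled Artin groups.

variable {S : Type*} {Γ : SimpleGraph S} {H : Type*} [Group H]

/-- The homomorphism from a right-angled Artin group given by the images of the generators. -/
def lift (f : S → H) (hf : ∀ u v, Γ.Adj u v → Commute (f u) (f v)) : RAAG Γ →* H :=
  PresentedGroup.toGroup (f := f) (by
    rintro _ ⟨u, v, h, rfl⟩
    simp only [map_mul, map_inv, FreeGroup.lift_apply_of]
    rw [(hf u v h).eq]
    group)

@[simp]
theorem lift_of (f : S → H) (hf : ∀ u v, Γ.Adj u v → Commute (f u) (f v)) (s : S) :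
    lift f hf (PresentedGroup.of s) = f s :=
  PresentedGroup.toGroup.of _

theorem commute_of {u v : S} (h : Γ.Adj u v) :
    Commute (PresentedGroup.of u : RAAG Γ) (PresentedGroup.of v) := by
  have := PresentedGroup.one_of_mem (rels := {r : FreeGroup S | ∃ u v : S, Γ.Adj u v ∧
      r = FreeGroup.of u * FreeGroup.of v * (FreeGroup.of u)⁻¹ * (FreeGroup.of v)⁻¹})
      ⟨u, v, h, rfl⟩
  simp only [map_mul, map_inv] at this
  exact mul_inv_eq_iff_eq_mul.mp (mul_inv_eq_one.mp this)

theorem of_ne_one (s : S) : (PresentedGroup.of s : RAAG Γ) ≠ 1 := by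
  intro h
  have := congrArg (lift (Γ := Γ) (fun _ => Multiplicative.ofAdd (1 : ℤ))
    (fun _ _ _ => Commute.all _ _)) h
  rw [lift_of, MonoidHom.map_one] at this
  exact Multiplicative.ofAdd.injective.ne one_ne_zero this

/-- A generator or its inverse. -/
def letter (Γ : SimpleGraph S) (a : S × Bool) : RAAG Γ :=
  if a.2 then PresentedGroup.of a.1 else (PresentedGroup.of a.1)⁻¹

theorem letter_mul_letter_not (a : S × Bool) :
    letter Γ a * letter Γ (a.1, !a.2) = 1 := by
  rcases a with ⟨v, _ | _⟩ <;> simp [letter]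

theorem commute_letter {a b : S × Bool} (h : Γ.Adj a.1 b.1) :
    Commute (letter Γ a) (letter Γ b) := by
  have := commute_of h
  unfold letter
  split_ifs <;> simp [this]

/-- `Reach g D` says that `g` has a reduced expression, and that `D` is the set of the letters
with which a reduced expression of `g` may start. -/
inductive Reach : RAAG Γ → Set (S × Bool) → Prop
  | one : Reach 1 ∅
  | mul {g : RAAG Γ} {D : Set (S × Bool)} (a : S × Bool) (h : Reach g D) (ha : (a.1, !a.2) ∉ D) :
      Reach (letter Γ a * g) (insert a (D ∩ {u | Γ.Adj a.1 u.1}))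

/-- A letter of `D` other than the one added last commutes with that one, so inductively it can be
moved to the front. -/
theorem Reach.exists_eq_letter_mul {g : RAAG Γ} {D : Set (S × Bool)} (h : Reach g D)
    {a : S × Bool} (ha : a ∈ D) :
    ∃ g' D', Reach g' D' ∧ g = letter Γ a * g' ∧ (a.1, !a.2) ∉ D' ∧
      D = insert a (D' ∩ {u | Γ.Adj a.1 u.1}) := by
  induction h with
  | one => simp at ha
  | @mul g D b h hb ih =>
    rcases ha with rfl | ⟨ha, hba⟩
    · exact ⟨g, D, h, rfl, hb, rfl⟩
    obtain ⟨g', D', h', rfl, ha', rfl⟩ := ih ha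
    have hba : Γ.Adj b.1 a.1 := hba
    have hb' : (b.1, !b.2) ∉ D' := fun hm => hb (Or.inr ⟨hm, hba.symm⟩)
    refine ⟨_, _, h'.mul b hb', ?_, ?_, ?_⟩
    · rw [← mul_assoc, ← mul_assoc, (commute_letter hba).eq]
    · rintro (h1 | h1)
      · exact hba.ne (congrArg Prod.fst h1).symm
      · exact ha' h1.1
    · ext u
      have := hba.symm
      simp only [Set.mem_insert_iff, Set.mem_inter_iff, Set.mem_ofPred_eq]
      constructor
      · rintro (rfl | ⟨rfl | ⟨h1, h2⟩, h3⟩)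
        · exact Or.inr ⟨Or.inl rfl, this⟩
        · exact Or.inl rfl
        · exact Or.inr ⟨Or.inr ⟨h1, h3⟩, h2⟩
      · rintro (rfl | ⟨rfl | ⟨h1, h2⟩, h3⟩)
        · exact Or.inr ⟨Or.inl rfl, hba⟩
        · exact Or.inl rfl
        · exact Or.inr ⟨Or.inr ⟨h1, h3⟩, h2⟩

theorem exists_reach_letter_mul {g : RAAG Γ} (h : ∃ D, Reach g D) (a : S × Bool) :
    ∃ D, Reach (letter Γ a * g) D := by
  obtain ⟨D, h⟩ := h
  by_cases ha : (a.1, !a.2) ∈ D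
  · obtain ⟨g', D', h', rfl, -⟩ := h.exists_eq_letter_mul ha
    rw [← mul_assoc, letter_mul_letter_not, one_mul]
    exact ⟨D', h'⟩
  · exact ⟨_, h.mul a ha⟩

theorem exists_reach (g : RAAG Γ) : ∃ D, Reach g D := by
  suffices h : ∀ g' : RAAG Γ, (∃ D, Reach g' D) →
      (∃ D, Reach (g * g') D) ∧ ∃ D, Reach (g⁻¹ * g') D by
    simpa using (h 1 ⟨_, Reach.one⟩).1
  have hg : g ∈ Subgroup.closure (Set.range (PresentedGroup.of (rels := {r : FreeGroup S |
      ∃ u v : S, Γ.Adj u v ∧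
      r = FreeGroup.of u * FreeGroup.of v * (FreeGroup.of u)⁻¹ * (FreeGroup.of v)⁻¹}))) := by
    rw [PresentedGroup.closure_range_of]; trivial
  induction hg using Subgroup.closure_induction with
  | mem x hx =>
    obtain ⟨s, rfl⟩ := hx
    exact fun g' h => ⟨exists_reach_letter_mul h (s, true), exists_reach_letter_mul h (s, false)⟩
  | one => intro g' h; simpa using h
  | mul x y _ _ hx hy =>
    intro g' h
    rw [mul_inv_rev, mul_assoc, mul_assoc]
    exact ⟨(hx _ (hy _ h).1).1, (hy _ (hx _ h).2).2⟩
  | inv x _ hx =>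
    intro g' h
    rw [inv_inv]
    exact (hx g' h).symm

-- Ping-pong with reflections.

section Reflection

variable [Fintype S] (Γ)

open scoped Classical in
/-- The sum of the coordinates of `x` at the vertices that are not joined to `v`. -/
noncomputable def nonadjSum (v : S × Bool) : (S × Bool → ℤ) →ₗ[ℤ] ℤ :=
  ∑ u : S × Bool with u ≠ v ∧ ¬ Γ.Adj v.1 u.1, LinearMap.proj u

open scoped Classical in
theorem nonadjSum_apply (v : S × Bool) (x : S × Bool → ℤ) :
    nonadjSum Γ v x = ∑ u : S × Bool with u ≠ v ∧ ¬ Γ.Adj v.1 u.1, x u := by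
  simp [nonadjSum]

theorem nonadjSum_congr {v : S × Bool} {x y : S × Bool → ℤ}
    (h : ∀ u, u ≠ v → ¬ Γ.Adj v.1 u.1 → x u = y u) : nonadjSum Γ v x = nonadjSum Γ v y := by
  classical
  rw [nonadjSum_apply, nonadjSum_apply]
  exact Finset.sum_congr rfl fun u hu => by
    simp only [Finset.mem_filter] at hu
    exact h u hu.2.1 hu.2.2

theorem le_nonadjSum {u v : S × Bool} {x : S × Bool → ℤ} (hx : ∀ u, 0 ≤ x u) (huv : u ≠ v)
    (h : ¬ Γ.Adj v.1 u.1) : x u ≤ nonadjSum Γ v x := by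
  classical
  rw [nonadjSum_apply]
  exact Finset.single_le_sum (f := x) (fun i _ => hx i) (by simp [huv, h])

theorem nonadjSum_nonneg (v : S × Bool) {x : S × Bool → ℤ} (hx : ∀ u, 0 ≤ x u) :
    0 ≤ nonadjSum Γ v x := by
  classical
  rw [nonadjSum_apply]
  exact Finset.sum_nonneg fun i _ => hx i

open scoped Classical in
/-- The underlying linear map of `reflection`. -/
noncomputable def reflectionMap (v : S × Bool) : (S × Bool → ℤ) →ₗ[ℤ] (S × Bool → ℤ) where
  toFun x := Function.update x v (4 * nonadjSum Γ v x - x v)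
  map_add' x y := by
    ext u
    by_cases h : u = v
    · subst h; simp; ring
    · simp [h]
  map_smul' c x := by
    ext u
    by_cases h : u = v
    · subst h
      simp only [map_smul, Function.update_self, Pi.smul_apply, smul_eq_mul, RingHom.id_apply]
      ring
    · simp [h]

theorem reflectionMap_self (v : S × Bool) (x : S × Bool → ℤ) :
    reflectionMap Γ v x v = 4 * nonadjSum Γ v x - x v := by simp [reflectionMap]

theorem reflectionMap_of_ne {u v : S × Bool} (h : u ≠ v) (x : S × Bool → ℤ) :
    reflectionMap Γ v x u = x u := by simp [reflectionMap, h]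

theorem nonadjSum_reflectionMap_self (v : S × Bool) (x : S × Bool → ℤ) :
    nonadjSum Γ v (reflectionMap Γ v x) = nonadjSum Γ v x :=
  nonadjSum_congr Γ fun _ hu _ => reflectionMap_of_ne Γ hu x

theorem nonadjSum_reflectionMap_of_adj {u v : S × Bool} (h : Γ.Adj u.1 v.1)
    (x : S × Bool → ℤ) : nonadjSum Γ u (reflectionMap Γ v x) = nonadjSum Γ u x :=
  nonadjSum_congr Γ fun w _ hw => reflectionMap_of_ne Γ (by rintro rfl; exact hw h) x

/-- The reflection of `ℤ^(S × Bool)` in the direction of a coordinate. -/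
noncomputable def reflection (v : S × Bool) : (S × Bool → ℤ) ≃ₗ[ℤ] (S × Bool → ℤ) :=
  LinearEquiv.ofInvolutive (reflectionMap Γ v) fun x => by
    ext u
    by_cases h : u = v
    · subst h
      rw [reflectionMap_self, nonadjSum_reflectionMap_self, reflectionMap_self]
      ring
    · rw [reflectionMap_of_ne Γ h, reflectionMap_of_ne Γ h]

theorem reflection_apply (v : S × Bool) (x : S × Bool → ℤ) :
    reflection Γ v x = reflectionMap Γ v x := rfl

theorem reflection_inv (v : S × Bool) : (reflection Γ v)⁻¹ = reflection Γ v := rfl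

variable {Γ}

theorem commute_reflection {u v : S × Bool} (h : Γ.Adj u.1 v.1) :
    Commute (reflection Γ u) (reflection Γ v) := by
  have huv : u ≠ v := fun e => h.ne (congrArg Prod.fst e)
  ext x w
  simp only [LinearEquiv.mul_apply, reflection_apply]
  by_cases hu : w = u
  · subst hu
    rw [reflectionMap_self, reflectionMap_of_ne Γ huv, reflectionMap_of_ne Γ huv,
      nonadjSum_reflectionMap_of_adj Γ h, reflectionMap_self]
  by_cases hv : w = v
  · subst hv
    rw [reflectionMap_self, reflectionMap_of_ne Γ hu, reflectionMap_self,
      nonadjSum_reflectionMap_of_adj Γ h.symm, reflectionMap_of_ne Γ hu]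
  · simp [reflectionMap_of_ne, hu, hv]

/-- `x` has nonnegative coordinates and lies beyond exactly the walls of the reflections in `D`. -/
structure Beyond (Γ : SimpleGraph S) (D : Set (S × Bool)) (x : S × Bool → ℤ) : Prop where
  nonneg : ∀ v, 0 ≤ x v
  lt_of_mem : ∀ v ∈ D, 2 * nonadjSum Γ v x < x v
  lt_of_notMem : ∀ v ∉ D, x v < 2 * nonadjSum Γ v x

/-- The ping-pong step. Walls of letters joined to `v` are unaffected, since their sums omit the
coordinate `v`. For `u ≠ v` not joined to `v`, the new coordinate at `v` enters the sum at `u`; it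
exceeds twice the old sum at `v`, which is at least twice `x u`, so the new point lies strictly
before the wall of `u`. -/
theorem Beyond.reflection {D : Set (S × Bool)} {x : S × Bool → ℤ} (h : Beyond Γ D x)
    {v : S × Bool} (hv : v ∉ D) :
    Beyond Γ (insert v (D ∩ {u | Γ.Adj v.1 u.1})) (reflection Γ v x) := by
  have hlt := h.lt_of_notMem v hv
  have h0 := nonadjSum_nonneg Γ v h.nonneg
  have hnn : ∀ u, 0 ≤ reflectionMap Γ v x u := fun u => by
    by_cases hu : u = v
    · subst hu; rw [reflectionMap_self]; linarith
    · rw [reflectionMap_of_ne Γ hu]; exact h.nonneg u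
  refine ⟨hnn, ?_, ?_⟩
  · rintro u (rfl | ⟨hu, hvu⟩)
    · rw [reflection_apply, reflectionMap_self, nonadjSum_reflectionMap_self]; linarith
    · have hvu : Γ.Adj v.1 u.1 := hvu
      rw [reflection_apply, reflectionMap_of_ne Γ (fun e => hvu.ne (congrArg Prod.fst e.symm)),
        nonadjSum_reflectionMap_of_adj Γ hvu.symm]
      exact h.lt_of_mem u hu
  · intro u hu
    simp only [Set.mem_insert_iff, Set.mem_inter_iff, Set.mem_ofPred_eq, not_or, not_and] at hu
    obtain ⟨huv, hu⟩ := hu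
    rw [reflection_apply, reflectionMap_of_ne Γ huv]
    by_cases hvu : Γ.Adj v.1 u.1
    · rw [nonadjSum_reflectionMap_of_adj Γ hvu.symm]
      exact h.lt_of_notMem u fun hD => hu hD hvu
    · have h1 := le_nonadjSum Γ h.nonneg huv hvu
      have h2 := le_nonadjSum Γ hnn (Ne.symm huv) (fun e => hvu e.symm)
      rw [reflectionMap_self] at h2
      linarith

/-- The representation in which a generator acts as the product of two reflections. -/
noncomputable def reflectionRep (Γ : SimpleGraph S) :
    RAAG Γ →* ((S × Bool → ℤ) ≃ₗ[ℤ] (S × Bool → ℤ)) :=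
  lift (fun v => reflection Γ (v, true) * reflection Γ (v, false)) fun u v h =>
    ((commute_reflection (u := (u, true)) (v := (v, true)) h).mul_right
      (commute_reflection (u := (u, true)) (v := (v, false)) h)).mul_left
    ((commute_reflection (u := (u, false)) (v := (v, true)) h).mul_right
      (commute_reflection (u := (u, false)) (v := (v, false)) h))

theorem reflectionRep_letter (a : S × Bool) :
    reflectionRep Γ (letter Γ a) = reflection Γ a * reflection Γ (a.1, !a.2) := by
  rcases a with ⟨v, _ | _⟩ <;> simp [letter, reflectionRep, reflection_inv]

/-- A letter crosses the wall of its inverse and then its own. The inverse drops out of `D` again,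
because it is not joined to the letter. -/
theorem Reach.beyond {g : RAAG Γ} {D : Set (S × Bool)} (h : Reach g D) :
    Beyond Γ D (reflectionRep Γ g 1) := by
  induction h with
  | one =>
    have h0 : ∀ u, 0 ≤ (1 : S × Bool → ℤ) u := fun u => zero_le_one
    refine ⟨by simp, by simp, fun v _ => ?_⟩
    -- The inverse letter is not joined to `v`, so the sum is at least `1` and the wall is at `2` or
    -- more. With the factor `2` instead of `4` in the reflection, strictness could fail here.
    have := le_nonadjSum Γ (u := (v.1, !v.2)) (v := v) h0
      (by rcases v with ⟨v, _ | _⟩ <;> simp) (by simp)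
    simp only [map_one, LinearEquiv.coe_one, id_eq, Pi.one_apply] at this ⊢
    linarith
  | @mul g D a h ha ih =>
    have h1 := (ih.reflection ha).reflection (v := a) (by
      rcases a with ⟨v, _ | _⟩ <;> simp)
    rw [map_mul, reflectionRep_letter]
    have hD : insert a (insert (a.1, !a.2) (D ∩ {u | Γ.Adj a.1 u.1}) ∩ {u | Γ.Adj a.1 u.1}) =
        insert a (D ∩ {u | Γ.Adj a.1 u.1}) := by
      rw [Set.insert_inter_of_notMem (by simp), Set.inter_assoc, Set.inter_self]
    exact hD ▸ h1

/-- The walls that the image vector lies beyond determine `D`; no wall means that no letter was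
used. -/
theorem eq_one_of_reflectionRep_one {g : RAAG Γ} (h : reflectionRep Γ g 1 = 1) : g = 1 := by
  obtain ⟨D, hD⟩ := exists_reach g
  have hb := hD.beyond
  rw [h] at hb
  have h1 := (Reach.one (Γ := Γ)).beyond
  rw [MonoidHom.map_one, LinearEquiv.coe_one, id_eq] at h1
  have hemp : D = ∅ := Set.eq_empty_of_forall_notMem fun v hv =>
    lt_asymm (hb.lt_of_mem v hv) (h1.lt_of_notMem v (Set.notMem_empty v))
  cases hD with
  | one => rfl
  | mul a => exact absurd hemp (Set.insert_nonempty _ _).ne_empty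

end Reflection

-- Adjoining graph symmetries.

section Action

variable {Q : Type*} [Group Q] [MulAction Q S]
  (hQ : ∀ (q : Q) u v, Γ.Adj u v → Γ.Adj (q • u) (q • v))

/-- The endomorphism of a right-angled Artin group induced by a graph automorphism. -/
def smulHom (q : Q) : RAAG Γ →* RAAG Γ :=
  lift (fun v => PresentedGroup.of (q • v)) fun u v h => commute_of (hQ q u v h)

theorem smulHom_mul (q r : Q) : smulHom hQ (q * r) = (smulHom hQ q).comp (smulHom hQ r) :=
  PresentedGroup.ext fun v => by simp [smulHom, mul_smul]

theorem smulHom_one : smulHom hQ 1 = MonoidHom.id _ :=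
  PresentedGroup.ext fun v => by simp [smulHom]

/-- The action on a right-angled Artin group induced by an action on the graph. -/
def mulAut : Q →* MulAut (RAAG Γ) where
  toFun q := MonoidHom.toMulEquiv (smulHom hQ q) (smulHom hQ q⁻¹)
    (by rw [← smulHom_mul, inv_mul_cancel, smulHom_one])
    (by rw [← smulHom_mul, mul_inv_cancel, smulHom_one])
  map_one' := by ext x; exact DFunLike.congr_fun (smulHom_one hQ) x
  map_mul' q r := by ext x; exact DFunLike.congr_fun (smulHom_mul hQ q r) x

@[simp]
theorem mulAut_of (q : Q) (v : S) :
    mulAut hQ q (PresentedGroup.of v) = PresentedGroup.of (q • v) :=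
  lift_of (Γ := Γ) (fun v => PresentedGroup.of (q • v)) (fun u v h => commute_of (hQ q u v h)) v

/-- The permutation representation of `Q` on `ℤ^(S × Bool)`. -/
def permRep (Q S : Type*) [Group Q] [MulAction Q S] :
    Q →* ((S × Bool → ℤ) ≃ₗ[ℤ] (S × Bool → ℤ)) where
  toFun q := LinearEquiv.funCongrLeft ℤ ℤ
    ((MulAction.toPerm (q⁻¹) : Equiv.Perm S).prodCongr (Equiv.refl Bool))
  map_one' := by ext x u; simp [LinearEquiv.funCongrLeft_apply, LinearMap.funLeft_apply, Prod.map]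
  map_mul' q r := by
    ext x u; simp [LinearEquiv.funCongrLeft_apply, LinearMap.funLeft_apply, Prod.map, mul_smul]

theorem permRep_apply (q : Q) (x : S × Bool → ℤ) (u : S × Bool) :
    permRep Q S q x u = x (q⁻¹ • u.1, u.2) := rfl

variable [Fintype S]

theorem permRep_mul_reflection
    (hQ : ∀ (q : Q) u v, Γ.Adj u v → Γ.Adj (q • u) (q • v)) (q : Q) (v : S × Bool) :
    permRep Q S q * reflection Γ v = reflection Γ (q • v.1, v.2) * permRep Q S q := by
  classical
  have key : ∀ (x : S × Bool → ℤ),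
      nonadjSum Γ v x = nonadjSum Γ (q • v.1, v.2) (permRep Q S q x) := fun x => by
    rw [nonadjSum_apply, nonadjSum_apply]
    refine Finset.sum_nbij' (fun u => (q • u.1, u.2)) (fun u => (q⁻¹ • u.1, u.2)) ?_ ?_ ?_ ?_ ?_
    · rintro ⟨u, b⟩ hu
      simp only [Finset.mem_filter, Finset.mem_univ, true_and] at hu ⊢
      refine ⟨fun e => hu.1 ?_, fun e => hu.2 ?_⟩
      · simp only [Prod.mk.injEq, smul_left_cancel_iff] at e
        exact Prod.ext e.1 e.2
      · simpa using hQ q⁻¹ _ _ e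
    · rintro ⟨u, b⟩ hu
      simp only [Finset.mem_filter, Finset.mem_univ, true_and] at hu ⊢
      refine ⟨fun e => hu.1 ?_, fun e => hu.2 ?_⟩
      · rw [← e]; simp
      · simpa using hQ q _ _ e
    · simp
    · simp
    · simp [permRep_apply]
  ext x u
  simp only [LinearEquiv.mul_apply, permRep_apply, reflection_apply]
  by_cases h : u = (q • v.1, v.2)
  · subst h
    rw [reflectionMap_self, ← key, permRep_apply]
    simp [reflectionMap_self]
  · rw [reflectionMap_of_ne Γ h, permRep_apply, reflectionMap_of_ne]
    rintro rfl
    simp at h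

/-- The representation of the extension of a right-angled Artin group by symmetries. -/
noncomputable def extendedRep :
    RAAG Γ ⋊[mulAut hQ] Q →* ((S × Bool → ℤ) ≃ₗ[ℤ] (S × Bool → ℤ)) :=
  SemidirectProduct.lift (reflectionRep Γ) (permRep Q S) fun q => PresentedGroup.ext fun v => by
    simp only [MonoidHom.coe_comp, Function.comp_apply, MulEquiv.coe_toMonoidHom, mulAut_of,
      MulAut.conj_apply]
    rw [eq_mul_inv_iff_mul_eq]
    simp only [reflectionRep, lift_of]
    rw [← mul_assoc, permRep_mul_reflection hQ, mul_assoc, ← permRep_mul_reflection hQ q (v, false),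
      mul_assoc]

theorem extendedRep_injective [FaithfulSMul Q S] : Function.Injective (extendedRep hQ) := by
  rw [injective_iff_map_eq_one]
  intro g hg
  have hg' : reflectionRep Γ g.left * permRep Q S g.right = 1 := hg
  have h1 : permRep Q S g.right 1 = 1 := rfl
  have hl : g.left = 1 := eq_one_of_reflectionRep_one (by
    have := LinearEquiv.congr_fun hg' 1
    rwa [LinearEquiv.mul_apply, h1] at this)
  rw [hl, map_one, one_mul] at hg'
  have hr : g.right = 1 := by
    classical
    refine FaithfulSMul.eq_of_smul_eq_smul (α := S) fun s => ?_
    have := congrFun (LinearEquiv.congr_fun hg' (Pi.single (s, true) 1)) (g.right • s, true)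
    rw [permRep_apply, inv_smul_smul, Pi.single_eq_same, LinearEquiv.coe_one, id_eq] at this
    by_contra hne
    rw [Pi.single_eq_of_ne] at this
    · exact one_ne_zero this
    · intro e
      exact hne (by simpa using congrArg Prod.fst e)
  exact SemidirectProduct.ext hl hr

end Action

end RAAG

theorem IsLinearOver.of_injective {K G H : Type*} [CommRing K] [Group G] [Group H]
    (hH : IsLinearOver K H) (f : G →* H) (hf : Function.Injective f) : IsLinearOver K G := by
  obtain ⟨n, ρ, hρ⟩ := hH
  exact ⟨n, ρ.comp f, hρ.comp hf⟩

theorem isLinearOver_linearEquiv (K V : Type*) [CommRing K] [Finite V] :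
    IsLinearOver K ((V → K) ≃ₗ[K] (V → K)) := by
  classical
  have := Fintype.ofFinite V
  let b : Module.Basis (Fin (Fintype.card V)) K (V → K) :=
    (Pi.basisFun K V).reindex (Fintype.equivFin V)
  let e : ((V → K) ≃ₗ[K] (V → K)) ≃* Matrix.GeneralLinearGroup (Fin (Fintype.card V)) K :=
    (LinearMap.GeneralLinearGroup.generalLinearEquiv K (V → K)).symm.trans
      (Units.mapEquiv (LinearMap.toMatrixAlgEquiv b).toMulEquiv)
  exact ⟨_, e.toMonoidHom, e.injective⟩

theorem RAAG.isLinearOver_semidirectProduct {S Q : Type*} {Γ : SimpleGraph S} [Group Q]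
    [MulAction Q S] (hQ : ∀ (q : Q) u v, Γ.Adj u v → Γ.Adj (q • u) (q • v))
    [Finite S] [FaithfulSMul Q S] : IsLinearOver ℤ (RAAG Γ ⋊[RAAG.mulAut hQ] Q) := by
  have := Fintype.ofFinite S
  exact (isLinearOver_linearEquiv ℤ (S × Bool)).of_injective _ (RAAG.extendedRep_injective hQ)

-- Paths in Cayley graphs.

namespace FreeGroup

variable {X Q : Type*} [Group Q]

/-- The action of `Q` by left translation on the free group on the edges of a Cayley graph. -/
def translate (Q X : Type*) [Group Q] : Q →* MulAut (FreeGroup (Q × X)) where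
  toFun q := freeGroupCongr ((Equiv.mulLeft q).prodCongr (Equiv.refl X))
  map_one' := by
    ext x
    refine DFunLike.congr_fun (f := MulEquiv.toMonoidHom _) (g := MonoidHom.id _) ?_ x
    ext; simp
  map_mul' q r := by
    ext x
    refine DFunLike.congr_fun (f := MulEquiv.toMonoidHom _)
      (g := (MulEquiv.toMonoidHom _).comp (MulEquiv.toMonoidHom _)) ?_ x
    ext; simp [mul_assoc, Prod.map]

@[simp]
theorem translate_of (q r : Q) (x : X) : translate Q X q (of (r, x)) = of (q * r, x) := by
  simp [translate]

variable (π : FreeGroup X →* Q)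

/-- Sends an element of the free group to the path in the Cayley graph of `Q` along it, from `1`,
together with its end point. -/
def cayleyPathHom : FreeGroup X →* FreeGroup (Q × X) ⋊[translate Q X] Q :=
  FreeGroup.lift fun x => ⟨of (1, x), π (of x)⟩

theorem cayleyPathHom_right (f : FreeGroup X) : (cayleyPathHom π f).right = π f := by
  refine DFunLike.congr_fun (f := SemidirectProduct.rightHom.comp (cayleyPathHom π)) ?_ f
  ext x
  simp [cayleyPathHom]

/-- The path from `1` along an element of the free group, as a product of edges. -/
def cayleyPath (f : FreeGroup X) : FreeGroup (Q × X) := (cayleyPathHom π f).left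

@[simp]
theorem cayleyPath_of (x : X) : cayleyPath π (of x) = of (1, x) := by
  simp [cayleyPath, cayleyPathHom]

@[simp]
theorem cayleyPath_one : cayleyPath π 1 = 1 := by simp [cayleyPath]

theorem cayleyPath_mul (f g : FreeGroup X) :
    cayleyPath π (f * g) = cayleyPath π f * translate Q X (π f) (cayleyPath π g) := by
  simp [cayleyPath, cayleyPathHom_right]

/-- The edge that is traversed from the vertex `q` along a letter, with its direction. -/
def cayleyEdge (q : Q) (b : X × Bool) : (Q × X) × Bool :=
  ((if b.2 then q else q * (π (of b.1))⁻¹, b.1), b.2)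

/-- The edges that are traversed from the vertex `q` along a word. -/
def cayleyWord : Q → List (X × Bool) → List ((Q × X) × Bool)
  | _, [] => []
  | q, b :: L => cayleyEdge π q b :: cayleyWord (q * π (mk [b])) L

theorem mk_cons (b : X × Bool) (L : List (X × Bool)) : mk (b :: L) = mk [b] * mk L := by
  rw [mul_mk]; rfl

theorem translate_cayleyPath_mk (q : Q) (L : List (X × Bool)) :
    translate Q X q (cayleyPath π (mk L)) = mk (cayleyWord π q L) := by
  induction L generalizing q with
  | nil => simp [cayleyWord, ← one_eq_mk]
  | cons b L ih =>
    rw [mk_cons b L, cayleyPath_mul, _root_.map_mul, cayleyWord, mk_cons (cayleyEdge π q b), ← ih,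
      _root_.map_mul, MulAut.mul_apply]
    congr 1
    rcases b with ⟨x, _ | _⟩
    · have h : (mk [(x, false)] : FreeGroup X) = (of x)⁻¹ := rfl
      have h' : (mk [cayleyEdge π q (x, false)]) = (of (q * (π (of x))⁻¹, x))⁻¹ := by
        simp [cayleyEdge, of, inv_mk, invRev]
      rw [h, h', eq_inv_iff_mul_eq_one]
      have := cayleyPath_mul π (of x)⁻¹ (of x)
      rw [inv_mul_cancel, cayleyPath_one, cayleyPath_of, _root_.map_inv] at this
      rw [← _root_.map_one (translate Q X q), this, _root_.map_mul, ← MulAut.mul_apply,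
        ← _root_.map_mul, translate_of, mul_one]
    · have h : (mk [(x, true)] : FreeGroup X) = of x := rfl
      rw [h, cayleyPath_of, translate_of, mul_one]
      rfl

theorem length_cayleyWord (q : Q) (L : List (X × Bool)) :
    (cayleyWord π q L).length = L.length := by
  induction L generalizing q with
  | nil => rfl
  | cons b L ih => simp [cayleyWord, ih]

/-- Consecutive edges that cancel carry the same generator in opposite directions, so they come from
letters that cancel. -/
theorem IsReduced.cayleyWord {L : List (X × Bool)} (h : IsReduced L) (q : Q) :
    IsReduced (cayleyWord π q L) := by
  induction L generalizing q with
  | nil => exact IsReduced.nil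
  | cons b L ih =>
    cases L with
    | nil => exact IsReduced.singleton
    | cons b' L =>
      rw [isReduced_cons_cons] at h
      rw [FreeGroup.cayleyWord, FreeGroup.cayleyWord, isReduced_cons_cons]
      exact ⟨fun e => h.1 (congrArg Prod.snd e), ih h.2 _⟩

theorem cayleyPath_eq_one {f : FreeGroup X} (h : cayleyPath π f = 1) : f = 1 := by
  classical
  have h1 := translate_cayleyPath_mk π 1 f.toWord
  rw [mk_toWord, h, _root_.map_one] at h1
  have h2 := congrArg toWord h1
  rw [toWord_mk, (isReduced_toWord.cayleyWord π 1).reduce_eq, toWord_one] at h2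
  rw [← toWord_eq_nil_iff, ← List.length_eq_zero_iff, ← length_cayleyWord π 1, ← h2]
  rfl

/-- The retraction that kills the generators outside `A` fixes the element. Deleting a letter would
shorten a reduced word, so no letter is deleted. -/
theorem fst_mem_of_mk_mem_closure {α : Type*} {A : Set α} {L : List (α × Bool)}
    (hL : IsReduced L) (h : mk L ∈ Subgroup.closure (of '' A)) : ∀ b ∈ L, b.1 ∈ A := by
  classical
  let r : FreeGroup α →* FreeGroup α := FreeGroup.lift fun e => if e ∈ A then of e else 1
  have hr : Subgroup.closure (of '' A) ≤ r.eqLocus (MonoidHom.id _) := by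
    rw [Subgroup.closure_le]
    rintro _ ⟨e, he, rfl⟩
    show r (of e) = of e
    simp [r, he]
  have hf : ∀ L : List (α × Bool), r (mk L) = mk (L.filter fun b => b.1 ∈ A) := fun L => by
    induction L with
    | nil => simp [← one_eq_mk]
    | cons b L ih =>
      rw [mk_cons, _root_.map_mul, ih]
      rcases b with ⟨x, b⟩
      by_cases hx : x ∈ A
      · rw [List.filter_cons_of_pos (by simpa using hx), mk_cons]
        cases b <;> simp [r, hx, of, inv_mk, invRev]
      · rw [List.filter_cons_of_neg (by simpa using hx)]
        have : r (mk [(x, b)]) = 1 := by cases b <;> simp [r, hx]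
        rw [this, one_mul]
  have h1 : r (mk L) = mk L := hr h
  rw [hf] at h1
  have h2 : L.length ≤ (L.filter fun b => b.1 ∈ A).length := by
    calc L.length = (mk L).norm := by rw [norm, toWord_mk, hL.reduce_eq]
      _ ≤ _ := h1 ▸ norm_mk_le
  have h3 := List.length_filter_eq_length_iff.mp (le_antisymm (List.length_filter_le _ _) h2)
  exact fun b hb => by simpa using h3 b hb

/-- The inverse of a letter. -/
def letterInv (b : X × Bool) : X × Bool := (b.1, !b.2)

theorem mk_letterInv (b : X × Bool) : mk [letterInv b] = (mk [b])⁻¹ := by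
  simp [letterInv, inv_mk, invRev]

-- Words read along labelled cycles.

section Cycle

variable {l : ℕ} (a : ZMod l → X × Bool)

/-- The word read along `n` edges of a labelled cycle, from the vertex `j`. -/
def cycleWord : ZMod l → ℕ → List (X × Bool)
  | _, 0 => []
  | j, n + 1 => a j :: cycleWord (j + 1) n

/-- The word read along `n` edges of a labelled cycle, from the vertex `j`, backwards. -/
def cycleWordRev : ZMod l → ℕ → List (X × Bool)
  | _, 0 => []
  | j, n + 1 => letterInv (a (j - 1)) :: cycleWordRev (j - 1) n

theorem length_cycleWord (j : ZMod l) (n : ℕ) : (cycleWord a j n).length = n := by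
  induction n generalizing j with
  | zero => rfl
  | succ n ih => simp [cycleWord, ih]

theorem getElem_cycleWord (j : ZMod l) (n k : ℕ) (h : k < (cycleWord a j n).length) :
    (cycleWord a j n)[k] = a (j + k) := by
  induction n generalizing j k with
  | zero => simp [cycleWord] at h
  | succ n ih =>
    cases k with
    | zero => simp [cycleWord]
    | succ k =>
      simp only [cycleWord, List.getElem_cons_succ]
      rw [ih]
      push_cast
      congr 1
      ring

theorem cycleWord_add (j : ZMod l) (m n : ℕ) :
    cycleWord a j (m + n) = cycleWord a j m ++ cycleWord a (j + m) n := by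
  induction m generalizing j with
  | zero => simp [cycleWord]
  | succ m ih =>
    rw [Nat.succ_add, cycleWord, ih, cycleWord]
    push_cast
    rw [add_assoc j 1, add_comm (1 : ZMod l)]
    rfl

theorem mk_cycleWord_mul (k : ℕ) : mk (cycleWord a 0 (l * k)) = mk (cycleWord a 0 l) ^ k := by
  induction k with
  | zero => rfl
  | succ k ih => rw [Nat.mul_succ, cycleWord_add, ← mul_mk, ih, pow_succ]; simp

theorem mk_cycleWordRev (j : ZMod l) (n : ℕ) :
    mk (cycleWordRev a j n) = (mk (cycleWord a (j - n) n))⁻¹ := by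
  induction n generalizing j with
  | zero => rfl
  | succ n ih =>
    rw [cycleWordRev, mk_cons, ih, mk_letterInv, cycleWord_add, ← mul_mk, mul_inv_rev]
    push_cast
    have h1 : j - 1 - (n : ZMod l) = j - (n + 1) := by ring
    have h2 : j - (n + 1) + (n : ZMod l) = j - 1 := by ring
    rw [h1, h2]
    rfl

/-- In a labelled cycle, `CycleEdge a j x` says that an edge with the label `x` starts at the vertex
`j`. -/
def CycleEdge (j : ZMod l) (x : X) : Prop := a j = (x, true) ∨ a (j - 1) = (x, false)

/-- A permutation action of the free group that follows the labels of a cycle: the permutation of a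
letter that is read from `j` to `j + 1` maps `j + 1` to `j`. -/
structure FollowsCycle (ρ : FreeGroup X →* Equiv.Perm (ZMod l)) : Prop where
  pos : ∀ j x, a j = (x, true) → ρ (of x) (j + 1) = j
  neg : ∀ j x, a j = (x, false) → ρ (of x) j = j + 1

variable {a}

/-- A partial injection of a finite set extends to a permutation. -/
theorem exists_perm_of_rel {α : Type*} [Finite α] (r : α → α → Prop)
    (hr : ∀ b c c', r b c → r b c' → c = c') (hl : ∀ b b' c, r b c → r b' c → b = b') :
    ∃ σ : Equiv.Perm α, ∀ b c, r b c → σ b = c := by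
  classical
  have := Fintype.ofFinite α
  let e : {b // ∃ c, r b c} ≃ {c // ∃ b, r b c} :=
    { toFun := fun b => ⟨b.2.choose, b.1, b.2.choose_spec⟩
      invFun := fun c => ⟨c.2.choose, c.1, c.2.choose_spec⟩
      left_inv := fun b => Subtype.ext (hl _ _ _ (Exists.choose_spec (p := fun d => r d _) _)
        b.2.choose_spec)
      right_inv := fun c => Subtype.ext (hr _ _ _ (Exists.choose_spec (p := fun d => r _ d) _)
        c.2.choose_spec) }
  refine ⟨e.extendSubtype, fun b c h => ?_⟩
  rw [e.extendSubtype_apply_of_mem b ⟨c, h⟩]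
  exact hr b _ _ (Exists.choose_spec (p := fun d => r b d) _) h

/-- Cyclic reducedness is what makes the labels of each generator a partial injection on the
vertices of the cycle. -/
theorem exists_followsCycle [NeZero l]
    (hred : ∀ j, (a j).1 = (a (j + 1)).1 → (a j).2 = (a (j + 1)).2) :
    ∃ ρ : FreeGroup X →* Equiv.Perm (ZMod l), FollowsCycle a ρ := by
  have key : ∀ j k x, a j = (x, true) → a k = (x, false) → j + 1 ≠ k ∧ k + 1 ≠ j := by
    rintro j k x hj hk
    refine ⟨?_, ?_⟩ <;> rintro rfl
    · have := hred j; simp [hj, hk] at this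
    · have := hred k; simp [hj, hk] at this
  have h : ∀ x, ∃ σ : Equiv.Perm (ZMod l), ∀ b c,
      (a c = (x, true) ∧ b = c + 1) ∨ (a b = (x, false) ∧ c = b + 1) → σ b = c := fun x => by
    refine exists_perm_of_rel _ ?_ ?_
    · rintro b c c' (⟨h1, rfl⟩ | ⟨h1, rfl⟩) (⟨h2, h⟩ | ⟨h2, rfl⟩)
      · exact add_right_cancel h
      · exact absurd rfl (key _ _ _ h1 h2).1
      · exact absurd h.symm (key _ _ _ h2 h1).1
      · rfl
    · rintro b b' c (⟨h1, rfl⟩ | ⟨h1, rfl⟩) (⟨h2, h⟩ | ⟨h2, h⟩)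
      · exact h.symm
      · exact absurd h.symm (key _ _ _ h1 h2).2
      · exact absurd rfl (key _ _ _ h2 h1).2
      · exact add_right_cancel h
  choose σ hσ using h
  refine ⟨FreeGroup.lift σ, ⟨fun j x h => ?_, fun j x h => ?_⟩⟩
  · rw [lift_apply_of]; exact hσ x _ _ (Or.inl ⟨h, rfl⟩)
  · rw [lift_apply_of]; exact hσ x _ _ (Or.inr ⟨h, rfl⟩)

variable {κ : Q →* Equiv.Perm (ZMod l)} {π : FreeGroup X →* Q}

/-- Here `κ q⁻¹ 0` is the position on the cycle of the Cayley vertex `q`; the inverse explains the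
direction chosen in `FollowsCycle`. An edge over the cycle that is traversed from `q` either follows
the cycle forwards or retraces its previous edge. -/
theorem eq_or_eq_of_cayleyEdge (ha : FollowsCycle a (κ.comp π)) (q : Q) (b : X × Bool)
    (h : CycleEdge a (κ (cayleyEdge π q b).1.1⁻¹ 0) (cayleyEdge π q b).1.2) :
    (b = a (κ q⁻¹ 0) ∧ κ (q * π (mk [b]))⁻¹ 0 = κ q⁻¹ 0 + 1) ∨
    (b = letterInv (a (κ q⁻¹ 0 - 1)) ∧ κ (q * π (mk [b]))⁻¹ 0 = κ q⁻¹ 0 - 1) := by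
  have hpos : ∀ x j, a j = (x, true) → κ (π (of x)) (j + 1) = j := fun x j => ha.pos j x
  have hneg : ∀ x j, a j = (x, false) → κ (π (of x)) j = j + 1 := fun x j => ha.neg j x
  rcases b with ⟨x, _ | _⟩
  · have hm : κ (q * π (mk [(x, false)]))⁻¹ 0 = κ (π (of x)) (κ q⁻¹ 0) := by
      have : (mk [(x, false)] : FreeGroup X) = (of x)⁻¹ := rfl
      rw [this, _root_.map_inv π, mul_inv_rev, inv_inv, _root_.map_mul]; rfl
    have hm' : κ (cayleyEdge π q (x, false)).1.1⁻¹ 0 = κ (π (of x)) (κ q⁻¹ 0) := by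
      simp [cayleyEdge]
    rw [hm'] at h
    rw [hm]
    generalize κ q⁻¹ 0 = j at h ⊢
    rcases h with h | h
    · right
      have h1 := (κ (π (of x))).injective (hpos x _ h)
      rw [← h1, add_sub_cancel_right, h1, h]
      exact ⟨rfl, rfl⟩
    · left
      have h1 := hneg x _ h
      rw [sub_add_cancel] at h1
      have h2 := (κ (π (of x))).injective h1
      rw [← h2, sub_add_cancel, h2]
      rw [h2] at h
      exact ⟨h.symm, rfl⟩
  · have hm : κ (q * π (mk [(x, true)]))⁻¹ 0 = (κ (π (of x)))⁻¹ (κ q⁻¹ 0) := by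
      have : (mk [(x, true)] : FreeGroup X) = of x := rfl
      rw [this, mul_inv_rev, _root_.map_mul, _root_.map_inv κ (π (of x))]; rfl
    have hm' : κ (cayleyEdge π q (x, true)).1.1⁻¹ 0 = κ q⁻¹ 0 := by
      simp [cayleyEdge]
    rw [hm'] at h
    rw [hm]
    generalize κ q⁻¹ 0 = j at h ⊢
    rcases h with h | h
    · exact Or.inl ⟨h.symm, Equiv.Perm.inv_eq_iff_eq.mpr (hpos x _ h).symm⟩
    · right
      have h1 := hneg x _ h
      rw [sub_add_cancel] at h1
      exact ⟨by rw [h]; rfl, Equiv.Perm.inv_eq_iff_eq.mpr h1.symm⟩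

/-- A reduced path that does not start backwards can never turn back. -/
theorem eq_cycleWord (ha : FollowsCycle a (κ.comp π)) (L : List (X × Bool)) (hL : IsReduced L)
    (q : Q) (h : ∀ b ∈ cayleyWord π q L, CycleEdge a (κ b.1.1⁻¹ 0) b.1.2)
    (hq : ∀ b ∈ L.head?, b ≠ letterInv (a (κ q⁻¹ 0 - 1))) :
    L = cycleWord a (κ q⁻¹ 0) L.length ∧ κ (q * π (mk L))⁻¹ 0 = κ q⁻¹ 0 + L.length := by
  induction L generalizing q with
  | nil => simp [cycleWord, ← one_eq_mk]
  | cons b L ih =>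
    simp only [cayleyWord, List.mem_cons, forall_eq_or_imp] at h
    rcases eq_or_eq_of_cayleyEdge ha q b h.1 with ⟨hb, hp⟩ | ⟨hb, -⟩
    · have := ih (hL.infix ⟨[b], [], by simp⟩) _ h.2 (by
        rw [hp, add_sub_cancel_right, ← hb]
        rintro b' hb' rfl
        cases L with
        | nil => simp at hb'
        | cons b'' L =>
          simp only [List.head?_cons, Option.mem_def, Option.some.injEq] at hb'
          subst hb'
          rw [isReduced_cons_cons] at hL
          simpa [letterInv] using hL.1)
      rw [hp] at this
      refine ⟨?_, ?_⟩
      · rw [List.length_cons, cycleWord, ← this.1, ← hb]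
      · rw [mk_cons, _root_.map_mul, ← mul_assoc, this.2, List.length_cons]
        push_cast
        ring
    · exact absurd hb (hq b (by simp))

theorem eq_cycleWordRev (ha : FollowsCycle a (κ.comp π)) (L : List (X × Bool)) (hL : IsReduced L)
    (q : Q) (h : ∀ b ∈ cayleyWord π q L, CycleEdge a (κ b.1.1⁻¹ 0) b.1.2)
    (hq : ∀ b ∈ L.head?, b ≠ a (κ q⁻¹ 0)) :
    L = cycleWordRev a (κ q⁻¹ 0) L.length ∧ κ (q * π (mk L))⁻¹ 0 = κ q⁻¹ 0 - L.length := by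
  induction L generalizing q with
  | nil => simp [cycleWordRev, ← one_eq_mk]
  | cons b L ih =>
    simp only [cayleyWord, List.mem_cons, forall_eq_or_imp] at h
    rcases eq_or_eq_of_cayleyEdge ha q b h.1 with ⟨hb, -⟩ | ⟨hb, hp⟩
    · exact absurd hb (hq b (by simp))
    · have := ih (hL.infix ⟨[b], [], by simp⟩) _ h.2 (by
        rw [hp]
        rintro b' hb' rfl
        cases L with
        | nil => simp at hb'
        | cons b'' L =>
          simp only [List.head?_cons, Option.mem_def, Option.some.injEq] at hb'
          subst hb'
          rw [isReduced_cons_cons, hb] at hL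
          simpa [letterInv] using hL.1)
      rw [hp] at this
      refine ⟨?_, ?_⟩
      · rw [List.length_cons, cycleWordRev, ← this.1, ← hb]
      · rw [mk_cons, _root_.map_mul, ← mul_assoc, this.2, List.length_cons]
        push_cast
        ring

/-- The reduced word runs around the cycle in one constant direction and returns to position `0`, so
its length is a multiple of `l`. -/
theorem mem_zpowers_of_cayleyPath_mem (ha : FollowsCycle a (κ.comp π))
    (hred : ∀ j, (a j).1 = (a (j + 1)).1 → (a j).2 = (a (j + 1)).2) {f : FreeGroup X}
    (hf : cayleyPath π f ∈ Subgroup.closure (of '' {e | CycleEdge a (κ e.1⁻¹ 0) e.2}))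
    (h0 : κ (π f) 0 = 0) : f ∈ Subgroup.zpowers (mk (cycleWord a 0 l)) := by
  classical
  have h1 := translate_cayleyPath_mk π 1 f.toWord
  rw [mk_toWord, _root_.map_one, MulAut.one_apply] at h1
  have hr : IsReduced f.toWord := isReduced_toWord
  have hmem := fst_mem_of_mk_mem_closure (hr.cayleyWord π 1) (h1 ▸ hf)
  have h0' : κ (1 * π (mk f.toWord))⁻¹ 0 = 0 := by
    rw [mk_toWord, one_mul, _root_.map_inv, Equiv.Perm.inv_eq_iff_eq, h0]
  by_cases hh : ∀ b ∈ f.toWord.head?, b ≠ letterInv (a (κ (1 : Q)⁻¹ 0 - 1))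
  · obtain ⟨h2, h3⟩ := eq_cycleWord ha f.toWord hr 1 hmem hh
    rw [h0'] at h3
    simp only [inv_one, _root_.map_one, Equiv.Perm.coe_one, id_eq, zero_add] at h2 h3
    obtain ⟨k, hk⟩ := (ZMod.natCast_eq_zero_iff _ _).mp h3.symm
    refine ⟨k, ?_⟩
    rw [hk] at h2
    show mk (cycleWord a 0 l) ^ (k : ℤ) = f
    rw [zpow_natCast, ← mk_cycleWord_mul, ← h2, mk_toWord]
  · push Not at hh
    obtain ⟨b, hb, hb'⟩ := hh
    obtain ⟨h2, h3⟩ := eq_cycleWordRev ha f.toWord hr 1 hmem (by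
      rintro b' h rfl
      obtain rfl := Option.mem_unique hb h
      -- The first letter retraces the previous edge of the cycle; by reducedness at `0` it is not
      -- the next edge as well.
      have := hred (κ (1 : Q)⁻¹ 0 - 1)
      rw [sub_add_cancel, hb'] at this
      simp [letterInv] at this)
    rw [h0'] at h3
    simp only [inv_one, _root_.map_one, Equiv.Perm.coe_one, id_eq, zero_sub] at h2 h3
    obtain ⟨k, hk⟩ := (ZMod.natCast_eq_zero_iff _ _).mp (neg_eq_zero.mp h3.symm)
    refine ⟨-k, ?_⟩
    show mk (cycleWord a 0 l) ^ (-k : ℤ) = f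
    rw [zpow_neg, zpow_natCast, ← mk_cycleWord_mul, ← mk_toWord (x := f), h2, mk_cycleWordRev, hk]
    simp

end Cycle

theorem exists_conj_cycleWord {f : FreeGroup X} (hf : f ≠ 1) :
    ∃ (l : ℕ) (_ : NeZero l) (a : ZMod l → X × Bool) (h : FreeGroup X),
      (∀ j, (a j).1 = (a (j + 1)).1 → (a j).2 = (a (j + 1)).2) ∧
      f = h * mk (cycleWord a 0 l) * h⁻¹ := by
  classical
  have hc := reduceCyclically.conj_conjugator_reduceCyclically f.toWord
  have hr := reduceCyclically.isCyclicallyReduced (isReduced_toWord (x := f))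
  set L := reduceCyclically f.toWord with hL
  set h := reduceCyclically.conjugator f.toWord
  have hfL : f = mk h * mk L * (mk h)⁻¹ := by
    rw [inv_mk, mul_mk, mul_mk, hc, mk_toWord]
  have hL0 : L.length ≠ 0 := fun e => hf (by
    rw [hfL, List.length_eq_zero_iff.mp e, ← one_eq_mk]; group)
  have hne : NeZero L.length := ⟨hL0⟩
  refine ⟨L.length, hne, fun j => L[j.val]'(ZMod.val_lt j), mk h, fun j => ?_, ?_⟩
  · by_cases hj : j.val + 1 < L.length
    · have hv : (j + 1).val = j.val + 1 := by
        have : j + 1 = ((j.val + 1 : ℕ) : ZMod L.length) := by simp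
        rw [this, ZMod.val_natCast_of_lt hj]
      simp only [hv]
      exact List.isChain_iff_getElem.mp hr.1 _ hj
    -- The wrap-around: cyclic reducedness compares the last letter with the first.
    · have hj' : j.val + 1 = L.length := le_antisymm (ZMod.val_lt j) (not_lt.mp hj)
      have hv : (j + 1).val = 0 := by
        rw [ZMod.val_eq_zero, ← ZMod.natCast_zmod_val j]
        rw_mod_cast [hj']
        exact ZMod.natCast_self _
      simp only [hv]
      refine hr.2 _ ?_ _ ?_
      · have : j.val = L.length - 1 := by omega
        simp [List.getLast?_eq_getElem?, this]
      · rw [List.head?_eq_getElem?]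
        simp
  · have : cycleWord (fun j : ZMod L.length => L[j.val]'(ZMod.val_lt j)) 0 L.length = L := by
      refine List.ext_getElem (length_cycleWord _ _ _) fun k h1 h2 => ?_
      rw [getElem_cycleWord]
      simp only [zero_add, ZMod.val_natCast_of_lt h2]
    rw [this, ← hfL]

end FreeGroup

open FreeGroup (CycleEdge FollowsCycle cycleWord cayleyPath cayleyPathHom)

-- The cover graph and the homomorphism to its group.

section Cover

variable {X ι : Type*} {l : ι → ℕ} (a : ∀ i, ZMod (l i) → X × Bool) {S : ι → Type*}
  (Γ : ∀ i, SimpleGraph (S i)) (s : ∀ i, S i)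

/-- The product of the groups of permutations of the vertices of the cycles. -/
abbrev CyclePerms (l : ι → ℕ) : Type _ := ∀ i, Equiv.Perm (ZMod (l i))

/-- The vertices of `coverGraph`: the edges of a Cayley graph of `CyclePerms l`, and a copy of each
`S i` for each vertex of the `i`-th cycle. -/
inductive CoverVertex (X : Type*) {ι : Type*} (l : ι → ℕ) (S : ι → Type*)
  | edge (q : CyclePerms l) (x : X) : CoverVertex X l S
  | vertex (i : ι) (t : S i) (ω : ZMod (l i)) : CoverVertex X l S

namespace CoverVertex

instance : MulAction (CyclePerms l) (CoverVertex X l S) where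
  smul q v := match v with
    | edge r x => edge (q * r) x
    | vertex i t ω => vertex i t (q i ω)
  one_smul v := by cases v <;> rfl
  mul_smul q r v := by cases v <;> rfl

@[simp]
theorem smul_edge (q r : CyclePerms l) (x : X) :
    q • (edge r x : CoverVertex X l S) = edge (q * r) x := rfl

@[simp]
theorem smul_vertex (q : CyclePerms l) (i : ι) (t : S i) (ω : ZMod (l i)) :
    q • (vertex i t ω : CoverVertex X l S) = vertex i t (q i ω) := rfl

theorem faithfulSMul (s : ∀ i, S i) : FaithfulSMul (CyclePerms l) (CoverVertex X l S) where
  eq_of_smul_eq_smul {q r} h := by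
    ext i ω
    simpa using h (vertex i (s i) ω)

instance [Finite X] [Finite ι] [∀ i, Finite (S i)] [∀ i, NeZero (l i)] :
    Finite (CoverVertex X l S) := by
  refine Finite.of_surjective
    (Sum.elim (fun e => edge e.1 e.2) (fun v => vertex v.1 v.2.1 v.2.2) :
      (CyclePerms l × X) ⊕ (Σ i, S i × ZMod (l i)) → CoverVertex X l S) ?_
  rintro (⟨q, x⟩ | ⟨i, t, ω⟩)
  · exact ⟨Sum.inl (q, x), rfl⟩
  · exact ⟨Sum.inr ⟨i, t, ω⟩, rfl⟩

end CoverVertex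

open CoverVertex

/-- The relation that generates the adjacency in `coverGraph`. -/
inductive CoverRel : CoverVertex X l S → CoverVertex X l S → Prop
  | vertex (i : ι) (t u : S i) (ω : ZMod (l i)) (h : (Γ i).Adj t u) :
      CoverRel (vertex i t ω) (vertex i u ω)
  | edge (i : ι) (t : S i) (ω : ZMod (l i)) (q : CyclePerms l) (x : X) (h : (Γ i).Adj t (s i))
      (hx : CycleEdge (a i) ((q i)⁻¹ ω) x) : CoverRel (edge q x) (vertex i t ω)

/-- The graph on `CoverVertex X l S` in which the copies of the `Γ i` are disjoint subgraphs, and in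
which a neighbour of `s i` in a copy of `Γ i` is joined to the edges of the Cayley graph that lie
over the corresponding translate of the `i`-th cycle. -/
def coverGraph : SimpleGraph (CoverVertex X l S) := SimpleGraph.fromRel (CoverRel a Γ s)

variable {a Γ s}

theorem CoverRel.adj {v w : CoverVertex X l S} (h : CoverRel a Γ s v w) :
    (coverGraph a Γ s).Adj v w := by
  refine (SimpleGraph.fromRel_adj _ _ _).mpr ⟨?_, Or.inl h⟩
  cases h with
  | vertex i t u ω h =>
    intro e
    simp only [CoverVertex.vertex.injEq, heq_eq_eq, true_and, and_true] at e
    exact h.ne e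
  | edge => simp

theorem CoverRel.smul {v w : CoverVertex X l S} (h : CoverRel a Γ s v w) (q : CyclePerms l) :
    CoverRel a Γ s (q • v) (q • w) := by
  cases h with
  | vertex i t u ω h => exact .vertex i t u _ h
  | edge i t ω r x h hx => exact .edge i t _ _ x h (by simpa using hx)

theorem coverGraph_adj_smul (q : CyclePerms l) (v w : CoverVertex X l S)
    (h : (coverGraph a Γ s).Adj v w) : (coverGraph a Γ s).Adj (q • v) (q • w) := by
  rcases ((SimpleGraph.fromRel_adj _ _ _).mp h).2 with h | h
  · exact (h.smul q).adj
  · exact (h.smul q).adj.symm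

theorem commute_of_coverGraph_adj {H : Type*} [Group H] {f : CoverVertex X l S → H}
    (hf : ∀ v w, CoverRel a Γ s v w → Commute (f v) (f w)) (v w : CoverVertex X l S)
    (h : (coverGraph a Γ s).Adj v w) : Commute (f v) (f w) := by
  rcases ((SimpleGraph.fromRel_adj _ _ _).mp h).2 with h | h
  · exact hf _ _ h
  · exact (hf _ _ h).symm

variable (a Γ s)

/-- The extension of the right-angled Artin group of `coverGraph` by `CyclePerms l`. -/
abbrev CoverGroup : Type _ :=
  RAAG (coverGraph a Γ s) ⋊[RAAG.mulAut (coverGraph_adj_smul (a := a) (Γ := Γ) (s := s))]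
    CyclePerms l

theorem isLinearOver_coverGroup [Finite X] [Finite ι] [∀ i, Finite (S i)] [∀ i, NeZero (l i)] :
    IsLinearOver ℤ (CoverGroup a Γ s) := by
  have := faithfulSMul (X := X) (l := l) s
  exact RAAG.isLinearOver_semidirectProduct _

/-- The generator of `CoverGroup` of a vertex. -/
def coverGen (i : ι) (t : S i) (ω : ZMod (l i)) : CoverGroup a Γ s :=
  SemidirectProduct.inl (PresentedGroup.of (vertex i t ω))

/-- The inclusion of the free group on the edges of the Cayley graph. -/
def edgeHom : FreeGroup (CyclePerms l × X) →* RAAG (coverGraph a Γ s) :=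
  FreeGroup.lift fun e => PresentedGroup.of (edge e.1 e.2)

variable (π : FreeGroup X →* CyclePerms l)

/-- The embedding of a free group by means of paths in a Cayley graph. -/
def coverFreeHom : FreeGroup X →* CoverGroup a Γ s :=
  (SemidirectProduct.map (edgeHom a Γ s) (MonoidHom.id _) (fun q => by
    ext ⟨r, x⟩
    simp [edgeHom])).comp (cayleyPathHom π)

theorem coverFreeHom_left (f : FreeGroup X) :
    (coverFreeHom a Γ s π f).left = edgeHom a Γ s (cayleyPath π f) := rfl

theorem coverFreeHom_right (f : FreeGroup X) : (coverFreeHom a Γ s π f).right = π f :=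
  FreeGroup.cayleyPathHom_right π f

theorem coverFreeHom_eq (f : FreeGroup X) : coverFreeHom a Γ s π f =
    SemidirectProduct.inl (edgeHom a Γ s (cayleyPath π f)) * SemidirectProduct.inr (π f) := by
  rw [← SemidirectProduct.inl_left_mul_inr_right (coverFreeHom a Γ s π f), coverFreeHom_left,
    coverFreeHom_right]

theorem coverFreeHom_conj_coverGen (f : FreeGroup X) (i : ι) (t : S i) (ω : ZMod (l i)) :
    coverFreeHom a Γ s π f * coverGen a Γ s i t ω * (coverFreeHom a Γ s π f)⁻¹ =
      SemidirectProduct.inl (edgeHom a Γ s (cayleyPath π f) *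
        PresentedGroup.of (vertex i t (π f i ω)) * (edgeHom a Γ s (cayleyPath π f))⁻¹) := by
  rw [coverFreeHom_eq, coverGen, mul_inv_rev, map_mul, map_mul, map_inv, ← smul_vertex,
    ← RAAG.mulAut_of (coverGraph_adj_smul (a := a) (Γ := Γ) (s := s)), SemidirectProduct.inl_aut,
    map_inv]
  group

variable {a Γ s π}

/-- Conjugation by `x` moves the copy `ω` by the permutation of `x` and then conjugates by the edge
`(1, x)`. The latter does nothing when this edge lies over the cycle. -/
theorem coverFreeHom_of_conj {i : ι} {t : S i} (h : (Γ i).Adj t (s i)) {x : X} {ω : ZMod (l i)}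
    (hx : CycleEdge (a i) (π (FreeGroup.of x) i ω) x) :
    coverFreeHom a Γ s π (FreeGroup.of x) * coverGen a Γ s i t ω *
      (coverFreeHom a Γ s π (FreeGroup.of x))⁻¹ =
      coverGen a Γ s i t (π (FreeGroup.of x) i ω) := by
  rw [coverFreeHom_conj_coverGen, FreeGroup.cayleyPath_of, coverGen]
  congr 1
  rw [mul_inv_eq_iff_eq_mul, edgeHom, FreeGroup.lift_apply_of]
  exact RAAG.commute_of (CoverRel.edge i t _ 1 x h (by simpa using hx)).adj

theorem coverFreeHom_letter_conj (hπ : ∀ i, FollowsCycle (a i) ((Pi.evalMonoidHom _ i).comp π))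
    {i : ι} {t : S i} (h : (Γ i).Adj t (s i)) (j : ZMod (l i)) :
    coverFreeHom a Γ s π (FreeGroup.mk [a i j]) * coverGen a Γ s i t (j + 1) *
      (coverFreeHom a Γ s π (FreeGroup.mk [a i j]))⁻¹ = coverGen a Γ s i t j := by
  rcases haj : a i j with ⟨x, _ | _⟩
  · have h1 : (FreeGroup.mk [(x, false)] : FreeGroup X) = (FreeGroup.of x)⁻¹ := rfl
    have h2 : π (FreeGroup.of x) i j = j + 1 := (hπ i).neg j x haj
    have h3 := coverFreeHom_of_conj (a := a) (π := π) h (x := x) (ω := j)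
      (Or.inr (by rw [h2, add_sub_cancel_right, haj]))
    rw [h2] at h3
    rw [h1, ← h3, map_inv]
    group
  · have h1 : (FreeGroup.mk [(x, true)] : FreeGroup X) = FreeGroup.of x := rfl
    have h2 : π (FreeGroup.of x) i (j + 1) = j := (hπ i).pos j x haj
    have h3 := coverFreeHom_of_conj (a := a) (π := π) h (x := x) (ω := j + 1)
      (Or.inl (by rw [h2, haj]))
    rwa [h2, ← h1] at h3

theorem coverFreeHom_cycleWord_conj
    (hπ : ∀ i, FollowsCycle (a i) ((Pi.evalMonoidHom _ i).comp π))
    {i : ι} {t : S i} (h : (Γ i).Adj t (s i)) (j : ZMod (l i)) (n : ℕ) :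
    coverFreeHom a Γ s π (FreeGroup.mk (cycleWord (a i) j n)) * coverGen a Γ s i t (j + n) *
      (coverFreeHom a Γ s π (FreeGroup.mk (cycleWord (a i) j n)))⁻¹ = coverGen a Γ s i t j := by
  induction n generalizing j with
  | zero => simp [cycleWord, ← FreeGroup.one_eq_mk]
  | succ n ih =>
    have h1 := ih (j + 1)
    have h2 := coverFreeHom_letter_conj hπ h j
    rw [cycleWord, FreeGroup.mk_cons, map_mul, ← h2, ← h1]
    push_cast
    rw [add_assoc j, add_comm (1 : ZMod (l i))]
    group

/-- Each letter shifts the copy of `t` by one position, so a full turn brings it back to itself. -/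
theorem commute_coverFreeHom_cycleWord
    (hπ : ∀ i, FollowsCycle (a i) ((Pi.evalMonoidHom _ i).comp π))
    {i : ι} {t : S i} (h : (Γ i).Adj t (s i)) :
    Commute (coverFreeHom a Γ s π (FreeGroup.mk (cycleWord (a i) 0 (l i))))
      (coverGen a Γ s i t 0) := by
  have := coverFreeHom_cycleWord_conj hπ h 0 (l i)
  rw [ZMod.natCast_self, add_zero] at this
  exact mul_inv_eq_iff_eq_mul.mp this

theorem commute_coverGen {i : ι} {t u : S i} (h : (Γ i).Adj t u) (ω : ZMod (l i)) :
    Commute (coverGen a Γ s i t ω) (coverGen a Γ s i u ω) :=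
  (RAAG.commute_of (CoverRel.vertex i t u ω h).adj).map SemidirectProduct.inl

variable (h : ι → FreeGroup X)

open scoped Classical in
/-- The homomorphism from the right-angled Artin group of `Γ i` to `CoverGroup`. -/
noncomputable def coverRAAGHom (hπ : ∀ i, FollowsCycle (a i) ((Pi.evalMonoidHom _ i).comp π))
    (i : ι) : RAAG (Γ i) →* CoverGroup a Γ s :=
  (MulAut.conj (coverFreeHom a Γ s π (h i))).toMonoidHom.comp <|
    RAAG.lift (fun t => if t = s i then
        coverFreeHom a Γ s π (FreeGroup.mk (cycleWord (a i) 0 (l i)))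
      else coverGen a Γ s i t 0) fun t u htu => by
    split_ifs with ht hu hu
    · exact Commute.refl _
    · exact commute_coverFreeHom_cycleWord hπ (ht ▸ htu.symm)
    · exact (commute_coverFreeHom_cycleWord hπ (hu ▸ htu)).symm
    · exact commute_coverGen htu 0

theorem coverRAAGHom_of_self (hπ : ∀ i, FollowsCycle (a i) ((Pi.evalMonoidHom _ i).comp π))
    (i : ι) : coverRAAGHom (s := s) h hπ i (PresentedGroup.of (s i)) =
      coverFreeHom a Γ s π (h i * FreeGroup.mk (cycleWord (a i) 0 (l i)) * (h i)⁻¹) := by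
  simp [coverRAAGHom]

theorem coverRAAGHom_of_ne (hπ : ∀ i, FollowsCycle (a i) ((Pi.evalMonoidHom _ i).comp π))
    {i : ι} {t : S i} (ht : t ≠ s i) : coverRAAGHom (s := s) h hπ i (PresentedGroup.of t) =
      coverFreeHom a Γ s π (h i) * coverGen a Γ s i t 0 * (coverFreeHom a Γ s π (h i))⁻¹ := by
  simp [coverRAAGHom, ht]

end Cover

-- Injectivity through an action.

section Faithful

open CoverVertex

variable {X ι : Type*} {l : ι → ℕ} (a : ∀ i, ZMod (l i) → X × Bool) {S : ι → Type*}
  (Γ : ∀ i, SimpleGraph (S i)) (s : ∀ i, S i) (π : FreeGroup X →* CyclePerms l)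

/-- The edges of the Cayley graph that lie over the edges of the `i`-th cycle, if this cycle is
translated so that its vertex `0` goes to `ω`. -/
def cycleEdges (i : ι) (ω : ZMod (l i)) : Set (CyclePerms l × X) :=
  {e | CycleEdge (a i) ((e.1 i)⁻¹ ω) e.2}

variable {a π}

/-- Translation by the inverse of `π f'` moves the path from `f'` to `f` to one that starts at `1`.
-/
theorem inv_mul_mem_zpowers (hπ : ∀ i, FollowsCycle (a i) ((Pi.evalMonoidHom _ i).comp π))
    (hred : ∀ i j, (a i j).1 = (a i (j + 1)).1 → (a i j).2 = (a i (j + 1)).2) {i : ι}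
    {f f' : FreeGroup X} (hf : π f i 0 = π f' i 0)
    (h : (cayleyPath π f')⁻¹ * cayleyPath π f ∈
      Subgroup.closure (FreeGroup.of '' cycleEdges a i (π f' i 0))) :
    f'⁻¹ * f ∈ Subgroup.zpowers (FreeGroup.mk (cycleWord (a i) 0 (l i))) := by
  refine FreeGroup.mem_zpowers_of_cayleyPath_mem (Q := CyclePerms l)
    (κ := Pi.evalMonoidHom (fun i => Equiv.Perm (ZMod (l i))) i) (π := π) (hπ i) (hred i) ?_ ?_
  · have h1 : (cayleyPath π f')⁻¹ * cayleyPath π f =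
        FreeGroup.translate _ X (π f') (cayleyPath π (f'⁻¹ * f)) := by
      rw [inv_mul_eq_iff_eq_mul, ← FreeGroup.cayleyPath_mul, mul_inv_cancel_left]
    rw [h1] at h
    have h2 := Subgroup.mem_map_of_mem
      (FreeGroup.translate (CyclePerms l) X (π f')⁻¹).toMonoidHom h
    rw [MonoidHom.map_closure, MulEquiv.coe_toMonoidHom, map_inv, MulAut.inv_apply_self] at h2
    refine Subgroup.closure_mono ?_ h2
    rintro _ ⟨_, ⟨⟨q, x⟩, hx, rfl⟩, rfl⟩
    refine ⟨((π f')⁻¹ * q, x), ?_, by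
      rw [← map_inv (FreeGroup.translate (CyclePerms l) X), FreeGroup.translate_of]⟩
    show CycleEdge (a i) ((((π f')⁻¹ * q)⁻¹ i) 0) x
    rw [mul_inv_rev, inv_inv]
    exact hx
  · simp [hf]

variable {G : Type*} [Group G] (a π) (j : FreeGroup X →* G) (θ : ∀ i, S i → G)

/-- The conjugate of `θ i t` by the image of `f`. -/
def conjElt (f : FreeGroup X) (i : ι) (t : S i) : G := j f * θ i t * (j f)⁻¹

/-- The edges of the Cayley graph that are joined to `vertex i t ω` in `coverGraph`. -/
def linkEdges (i : ι) (t : S i) (ω : ZMod (l i)) : Set (CyclePerms l × X) :=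
  {e | (Γ i).Adj t (s i) ∧ e ∈ cycleEdges a i ω}

/-- `f` goes to `ω`, and its path lies in the coset of `p` that `vertex i t ω` determines. -/
def Reaches (i : ι) (t : S i) (ω : ZMod (l i)) (p : FreeGroup (CyclePerms l × X))
    (f : FreeGroup X) : Prop :=
  π f i 0 = ω ∧ p⁻¹ * cayleyPath π f ∈ Subgroup.closure (FreeGroup.of '' linkEdges a Γ s i t ω)

open scoped Classical in
/-- The conjugate of `θ i t` that `vertex i t ω` and `p` determine, if there is one. -/
noncomputable def reachedElt (i : ι) (t : S i) (ω : ZMod (l i))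
    (p : FreeGroup (CyclePerms l × X)) : G :=
  if h : ∃ f, Reaches a Γ s π i t ω p f then conjElt j θ h.choose i t else 1

variable {a Γ s π j θ}

theorem Reaches.eq_cayleyPath {i : ι} {t : S i} {ω : ZMod (l i)}
    {p : FreeGroup (CyclePerms l × X)} {f : FreeGroup X} (h : Reaches a Γ s π i t ω p f)
    (ht : ¬ (Γ i).Adj t (s i)) : p = cayleyPath π f := by
  have h2 := h.2
  have : linkEdges a Γ s i t ω = ∅ := Set.eq_empty_of_forall_notMem fun e he => ht he.1
  rw [this, Set.image_empty, Subgroup.closure_empty, Subgroup.mem_bot] at h2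
  exact inv_mul_eq_one.mp h2

theorem Reaches.mem_cycleEdges {i : ι} {t : S i} {ω : ZMod (l i)}
    {p : FreeGroup (CyclePerms l × X)} {f : FreeGroup X} (h : Reaches a Γ s π i t ω p f) :
    p⁻¹ * cayleyPath π f ∈ Subgroup.closure (FreeGroup.of '' cycleEdges a i ω) :=
  Subgroup.closure_mono (Set.image_mono fun _ he => he.2) h.2

theorem Reaches.inv_mul_mem_zpowers
    (hπ : ∀ i, FollowsCycle (a i) ((Pi.evalMonoidHom _ i).comp π))
    (hred : ∀ i j, (a i j).1 = (a i (j + 1)).1 → (a i j).2 = (a i (j + 1)).2) {i : ι}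
    {t u : S i} {ω : ZMod (l i)} {p : FreeGroup (CyclePerms l × X)} {f f' : FreeGroup X}
    (h : Reaches a Γ s π i t ω p f) (h' : Reaches a Γ s π i u ω p f') :
    f'⁻¹ * f ∈ Subgroup.zpowers (FreeGroup.mk (cycleWord (a i) 0 (l i))) := by
  refine _root_.inv_mul_mem_zpowers hπ hred (h.1.trans h'.1.symm) ?_
  rw [h'.1]
  have := mul_mem (inv_mem h'.mem_cycleEdges) h.mem_cycleEdges
  simpa [mul_assoc] using this

theorem conjElt_eq_of_mem_zpowers {i : ι} {t : S i}
    (hθ : Commute (j (FreeGroup.mk (cycleWord (a i) 0 (l i)))) (θ i t)) {f f' : FreeGroup X}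
    (h : f'⁻¹ * f ∈ Subgroup.zpowers (FreeGroup.mk (cycleWord (a i) 0 (l i)))) :
    conjElt j θ f i t = conjElt j θ f' i t := by
  obtain ⟨k, hk⟩ := h
  obtain rfl := eq_mul_of_inv_mul_eq hk.symm
  have hc : Commute (j (FreeGroup.mk (cycleWord (a i) 0 (l i))) ^ k) (θ i t) := hθ.zpow_left k
  simp only [conjElt, map_mul, map_zpow, mul_inv_rev]
  rw [mul_assoc (j f'), hc.eq]
  group

/-- If `t` or `u` is joined to `s i`, its conjugator can be changed by powers of the cycle word. If
neither is, both paths equal `p`, so `f = f'`. -/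
theorem Reaches.exists_conjElt_eq
    (hπ : ∀ i, FollowsCycle (a i) ((Pi.evalMonoidHom _ i).comp π))
    (hred : ∀ i j, (a i j).1 = (a i (j + 1)).1 → (a i j).2 = (a i (j + 1)).2)
    (hθ : ∀ i t, (Γ i).Adj t (s i) →
      Commute (j (FreeGroup.mk (cycleWord (a i) 0 (l i)))) (θ i t))
    {i : ι} {t u : S i} {ω : ZMod (l i)} {p : FreeGroup (CyclePerms l × X)} {f f' : FreeGroup X}
    (h : Reaches a Γ s π i t ω p f) (h' : Reaches a Γ s π i u ω p f') :
    ∃ f'', conjElt j θ f i t = conjElt j θ f'' i t ∧ conjElt j θ f' i u = conjElt j θ f'' i u := by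
  by_cases ht : (Γ i).Adj t (s i)
  · exact ⟨f', conjElt_eq_of_mem_zpowers (hθ i t ht) (h.inv_mul_mem_zpowers hπ hred h'), rfl⟩
  by_cases hu : (Γ i).Adj u (s i)
  · exact ⟨f, rfl, conjElt_eq_of_mem_zpowers (hθ i u hu) (h'.inv_mul_mem_zpowers hπ hred h)⟩
  · have hp := (h.eq_cayleyPath ht).symm.trans (h'.eq_cayleyPath hu)
    have h1 : FreeGroup.translate _ X (π f') (cayleyPath π (f'⁻¹ * f)) = 1 := by
      rw [← mul_eq_left (a := cayleyPath π f'), ← FreeGroup.cayleyPath_mul, mul_inv_cancel_left, hp]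
    have h2 := FreeGroup.cayleyPath_eq_one π ((MulEquiv.map_eq_one_iff _).mp h1)
    exact ⟨f', by rw [inv_mul_eq_one.mp h2], rfl⟩

theorem reachedElt_eq (hπ : ∀ i, FollowsCycle (a i) ((Pi.evalMonoidHom _ i).comp π))
    (hred : ∀ i j, (a i j).1 = (a i (j + 1)).1 → (a i j).2 = (a i (j + 1)).2)
    (hθ : ∀ i t, (Γ i).Adj t (s i) →
      Commute (j (FreeGroup.mk (cycleWord (a i) 0 (l i)))) (θ i t))
    {i : ι} {t : S i} {ω : ZMod (l i)} {p : FreeGroup (CyclePerms l × X)} {f : FreeGroup X}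
    (h : Reaches a Γ s π i t ω p f) : reachedElt a Γ s π j θ i t ω p = conjElt j θ f i t := by
  have hex : ∃ f, Reaches a Γ s π i t ω p f := ⟨f, h⟩
  rw [reachedElt, dif_pos hex]
  obtain ⟨f'', h1, h2⟩ := hex.choose_spec.exists_conjElt_eq hπ hred hθ h
  rw [h1, h2]

theorem commute_reachedElt (hπ : ∀ i, FollowsCycle (a i) ((Pi.evalMonoidHom _ i).comp π))
    (hred : ∀ i j, (a i j).1 = (a i (j + 1)).1 → (a i j).2 = (a i (j + 1)).2)
    (hθ : ∀ i t, (Γ i).Adj t (s i) →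
      Commute (j (FreeGroup.mk (cycleWord (a i) 0 (l i)))) (θ i t))
    {i : ι} {t u : S i} (htu : Commute (θ i t) (θ i u)) (ω : ZMod (l i))
    (p : FreeGroup (CyclePerms l × X)) :
    Commute (reachedElt a Γ s π j θ i t ω p) (reachedElt a Γ s π j θ i u ω p) := by
  by_cases ht : ∃ f, Reaches a Γ s π i t ω p f
  · by_cases hu : ∃ f, Reaches a Γ s π i u ω p f
    · obtain ⟨f, hf⟩ := ht
      obtain ⟨f', hf'⟩ := hu
      obtain ⟨f'', h1, h2⟩ := hf.exists_conjElt_eq hπ hred hθ hf'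
      rw [reachedElt_eq hπ hred hθ hf, reachedElt_eq hπ hred hθ hf', h1, h2]
      exact (Commute.conj_iff (j f'')).mpr htu
    · rw [reachedElt, reachedElt, dif_neg hu]
      exact Commute.one_right _
  · rw [reachedElt, dif_neg ht]
    exact Commute.one_left _

/-- This invariance makes an edge and a vertex that are adjacent in `coverGraph` act by commuting
permutations. -/
theorem reachedElt_mul_inv {i : ι} {t : S i} {ω : ZMod (l i)} {e : CyclePerms l × X}
    (he : e ∈ linkEdges a Γ s i t ω) (p : FreeGroup (CyclePerms l × X)) :
    reachedElt a Γ s π j θ i t ω (p * (FreeGroup.of e)⁻¹) = reachedElt a Γ s π j θ i t ω p := by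
  have : Reaches a Γ s π i t ω (p * (FreeGroup.of e)⁻¹) = Reaches a Γ s π i t ω p := by
    ext f
    refine and_congr_right fun _ => ?_
    rw [mul_inv_rev, inv_inv, mul_assoc]
    exact Subgroup.mul_mem_cancel_left _ (Subgroup.subset_closure ⟨e, he, rfl⟩)
  rw [reachedElt, this]
  rfl

variable (a Γ s π j θ) in
/-- The permutation by which a vertex acts in `coverAction`. -/
noncomputable def coverPerm :
    CoverVertex X l S → Equiv.Perm (FreeGroup (CyclePerms l × X) × G)
  | edge q x => (Equiv.mulRight (FreeGroup.of (q, x))⁻¹).prodCongr (Equiv.refl G)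
  | vertex i t ω =>
      Equiv.prodShear (Equiv.refl _) fun p => Equiv.mulLeft (reachedElt a Γ s π j θ i t ω p)

/-- An action of the right-angled Artin group of `coverGraph`, in which the edges translate the
first coordinate and the other vertices change the second one. -/
noncomputable def coverAction
    (hπ : ∀ i, FollowsCycle (a i) ((Pi.evalMonoidHom _ i).comp π))
    (hred : ∀ i j, (a i j).1 = (a i (j + 1)).1 → (a i j).2 = (a i (j + 1)).2)
    (hθ : ∀ i t, (Γ i).Adj t (s i) →
      Commute (j (FreeGroup.mk (cycleWord (a i) 0 (l i)))) (θ i t))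
    (hθ' : ∀ i t u, (Γ i).Adj t u → Commute (θ i t) (θ i u)) :
    RAAG (coverGraph a Γ s) →* Equiv.Perm (FreeGroup (CyclePerms l × X) × G) :=
  RAAG.lift (coverPerm a Γ s π j θ) <| commute_of_coverGraph_adj fun v w h => by
    cases h with
    | vertex i t u ω h =>
      ext1 ⟨p, g⟩
      have := (commute_reachedElt hπ hred hθ (hθ' i t u h) ω p).eq
      simp only [Equiv.Perm.mul_apply, coverPerm, Equiv.prodShear_apply, Equiv.refl_apply,
        Equiv.coe_mulLeft, ← mul_assoc, this]
    | edge i t ω q x h hx =>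
      ext1 ⟨p, g⟩
      have he : (q, x) ∈ linkEdges a Γ s i t ω := ⟨h, hx⟩
      simp [Equiv.Perm.mul_apply, coverPerm, reachedElt_mul_inv he]

section

variable (hπ : ∀ i, FollowsCycle (a i) ((Pi.evalMonoidHom _ i).comp π))
    (hred : ∀ i j, (a i j).1 = (a i (j + 1)).1 → (a i j).2 = (a i (j + 1)).2)
    (hθ : ∀ i t, (Γ i).Adj t (s i) →
      Commute (j (FreeGroup.mk (cycleWord (a i) 0 (l i)))) (θ i t))
    (hθ' : ∀ i t u, (Γ i).Adj t u → Commute (θ i t) (θ i u))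

theorem coverAction_edgeHom (y p : FreeGroup (CyclePerms l × X)) (g : G) :
    coverAction hπ hred hθ hθ' (edgeHom a Γ s y) (p, g) = (p * y⁻¹, g) := by
  induction y using FreeGroup.induction_on generalizing p with
  | C1 => simp
  | of e => simp [edgeHom, coverAction, coverPerm]
  | inv_of e ih =>
    rw [map_inv, map_inv, Equiv.Perm.inv_eq_iff_eq, ih]
    simp
  | mul x y hx hy => rw [map_mul, map_mul, Equiv.Perm.mul_apply, hy, hx, mul_inv_rev, mul_assoc]

theorem coverAction_vertex (i : ι) (t : S i) (ω : ZMod (l i))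
    (p : FreeGroup (CyclePerms l × X)) (g : G) :
    coverAction hπ hred hθ hθ' (PresentedGroup.of (vertex i t ω)) (p, g) =
      (p, reachedElt a Γ s π j θ i t ω p * g) := by
  simp [coverAction, coverPerm]

/-- The elements whose image under `Φ` acts on the fibre over `1` in `coverAction` as they do. -/
noncomputable def actionSubgroup (Φ : G →* CoverGroup a Γ s) : Subgroup G where
  carrier := {n | (Φ n).right = 1 ∧
    ∀ g, coverAction hπ hred hθ hθ' (Φ n).left (1, g) = (1, n * g)}
  one_mem' := by simp
  mul_mem' := by
    rintro m n ⟨hm, hm'⟩ ⟨hn, hn'⟩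
    refine ⟨by simp [hm, hn], fun g => ?_⟩
    rw [map_mul, SemidirectProduct.mul_left, hm, map_one, MulAut.one_apply, map_mul,
      Equiv.Perm.mul_apply, hn', hm', mul_assoc]
  inv_mem' := by
    rintro n ⟨hn, hn'⟩
    refine ⟨by simp [hn], fun g => ?_⟩
    rw [map_inv, SemidirectProduct.inv_left, hn, inv_one, map_one, MulAut.one_apply, map_inv,
      Equiv.Perm.inv_eq_iff_eq, hn', mul_inv_cancel_left]

/-- The image is a vertex conjugated by the path of `f`: the action moves `1` to this path,
multiplies the second coordinate by the conjugate determined there, and moves back. -/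
theorem conjElt_mem_actionSubgroup (Φ : G →* CoverGroup a Γ s)
    (hΦ : ∀ f, Φ (j f) = coverFreeHom a Γ s π f) {i : ι} {t : S i}
    (ht : Φ (θ i t) = coverGen a Γ s i t 0) (f : FreeGroup X) :
    conjElt j θ f i t ∈ actionSubgroup hπ hred hθ hθ' Φ := by
  have h1 : Φ (conjElt j θ f i t) =
      coverFreeHom a Γ s π f * coverGen a Γ s i t 0 * (coverFreeHom a Γ s π f)⁻¹ := by
    rw [conjElt, map_mul, map_mul, map_inv, hΦ, ht]
  rw [coverFreeHom_conj_coverGen] at h1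
  have h2 : Reaches a Γ s π i t (π f i 0) (cayleyPath π f) f :=
    ⟨rfl, by rw [inv_mul_cancel]; exact one_mem _⟩
  refine ⟨by rw [h1]; rfl, fun g => ?_⟩
  rw [h1, SemidirectProduct.left_inl, map_mul, map_mul, Equiv.Perm.mul_apply, Equiv.Perm.mul_apply,
    ← map_inv (edgeHom a Γ s), coverAction_edgeHom, coverAction_vertex, coverAction_edgeHom,
    inv_inv, one_mul, mul_inv_cancel, reachedElt_eq hπ hred hθ h2]

end

end Faithful

universe u₁ u₂ u₃

/-- Every element is `n * j f` with `n` in a subgroup normalized by the image of `j`, whose elements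
act on the fibre over `1` as left multiplication. If the image is trivial, `(1, 1)` goes both to
`(1, n)` and to `(cayleyPath π f, 1)`. -/
theorem injective_of_coverGroup {X ι : Type*} {l : ι → ℕ} {a : ∀ i, ZMod (l i) → X × Bool}
    {S : ι → Type*} {Γ : ∀ i, SimpleGraph (S i)} {s : ∀ i, S i}
    {π : FreeGroup X →* CyclePerms l}
    (hπ : ∀ i, FollowsCycle (a i) ((Pi.evalMonoidHom _ i).comp π))
    (hred : ∀ i j, (a i j).1 = (a i (j + 1)).1 → (a i j).2 = (a i (j + 1)).2)
    {h : ι → FreeGroup X} {G : Type*} [Group G] {j : FreeGroup X →* G}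
    {b : ∀ i, RAAG (Γ i) →* G}
    (hjb : ∀ i, j (h i * FreeGroup.mk (cycleWord (a i) 0 (l i)) * (h i)⁻¹) =
      b i (PresentedGroup.of (s i)))
    (hgen : ∀ H : Subgroup G, (∀ f, j f ∈ H) → (∀ i x, b i x ∈ H) → H = ⊤)
    (Φ : G →* CoverGroup a Γ s) (hΦj : ∀ f, Φ (j f) = coverFreeHom a Γ s π f)
    (hΦb : ∀ i x, Φ (b i x) = coverRAAGHom h hπ i x) : Function.Injective Φ := by
  let θ : ∀ i, S i → G := fun i t => (j (h i))⁻¹ * b i (PresentedGroup.of t) * j (h i)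
  have hθ' : ∀ i t u, (Γ i).Adj t u → Commute (θ i t) (θ i u) := fun i t u htu => by
    have := (Commute.conj_iff (j (h i))⁻¹).mpr ((RAAG.commute_of htu).map (b i))
    simpa [θ] using this
  have hθs : ∀ i, j (FreeGroup.mk (cycleWord (a i) 0 (l i))) = θ i (s i) := fun i => by
    simp only [θ, ← hjb, map_mul, map_inv]
    group
  have hθ : ∀ i t, (Γ i).Adj t (s i) →
      Commute (j (FreeGroup.mk (cycleWord (a i) 0 (l i)))) (θ i t) := fun i t ht => by
    rw [hθs]
    exact hθ' i _ _ ht.symm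
  have hb : ∀ i t, b i (PresentedGroup.of t) = conjElt j θ (h i) i t := fun i t => by
    simp only [conjElt, θ]
    group
  have hθΦ : ∀ i t, t ≠ s i → Φ (θ i t) = coverGen a Γ s i t 0 := fun i t ht => by
    simp only [θ, map_mul, map_inv, hΦj, hΦb, coverRAAGHom_of_ne h hπ ht]
    group
  let N := actionSubgroup hπ hred hθ hθ' Φ
  -- The largest subgroup of `N` that is normalized by the image of `j`, so that its product with
  -- this image is a subgroup.
  let M : Subgroup G := ⨅ f, N.comap (MulAut.conj (j f)).toMonoidHom
  have hM : ∀ n, n ∈ M ↔ ∀ f, j f * n * (j f)⁻¹ ∈ N := fun n => by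
    simp [M, Subgroup.mem_iInf, Subgroup.mem_comap]
  have hMconj : ∀ n ∈ M, ∀ f, j f * n * (j f)⁻¹ ∈ M := fun n hn f => by
    rw [hM] at hn ⊢
    intro f'
    have := hn (f' * f)
    simpa only [map_mul, mul_inv_rev, mul_assoc] using this
  let H : Subgroup G :=
    { carrier := {g | ∃ n ∈ M, ∃ f, g = n * j f}
      one_mem' := ⟨1, one_mem _, 1, by simp⟩
      mul_mem' := by
        rintro _ _ ⟨n, hn, f, rfl⟩ ⟨n', hn', f', rfl⟩
        exact ⟨n * (j f * n' * (j f)⁻¹), mul_mem hn (hMconj n' hn' f), f * f', by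
          rw [map_mul]; group⟩
      inv_mem' := by
        rintro _ ⟨n, hn, f, rfl⟩
        refine ⟨_, hMconj n⁻¹ (inv_mem hn) f⁻¹, f⁻¹, ?_⟩
        rw [map_inv]
        group }
  have hjH : ∀ f, j f ∈ H := fun f => ⟨1, one_mem _, f, (one_mul _).symm⟩
  have hH : H = ⊤ := hgen H hjH fun i x => by
    refine PresentedGroup.generated_by _ (H.comap (b i)) (fun t => ?_) x
    show b i (PresentedGroup.of t) ∈ H
    by_cases ht : t = s i
    · rw [ht, ← hjb]
      exact hjH _
    · refine ⟨b i (PresentedGroup.of t), (hM _).mpr fun f => ?_, 1, by simp⟩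
      have := conjElt_mem_actionSubgroup hπ hred hθ hθ' Φ hΦj (hθΦ i t ht) (f * h i)
      rw [hb]
      simpa [conjElt, mul_assoc] using this
  rw [injective_iff_map_eq_one]
  intro g hg
  obtain ⟨n, hn, f, rfl⟩ : g ∈ H := hH ▸ Subgroup.mem_top g
  obtain ⟨hn1, hn2⟩ : n ∈ N := by simpa using (hM n).mp hn 1
  have h1 := congrArg SemidirectProduct.left hg
  rw [map_mul, SemidirectProduct.mul_left, hn1, map_one, MulAut.one_apply, hΦj, coverFreeHom_left,
    SemidirectProduct.one_left, mul_eq_one_iff_eq_inv, ← map_inv] at h1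
  have h2 := hn2 1
  rw [h1, coverAction_edgeHom, inv_inv, one_mul, mul_one, Prod.mk.injEq] at h2
  rw [FreeGroup.cayleyPath_eq_one π h2.1, ← h2.2, map_one, one_mul]

/-- The group enters only through its generation and its universal property, the latter in a
universe that contains `CoverGroup`. -/
theorem isLinearOver_of_star {X : Type u₁} {ι : Type u₂} {S : ι → Type u₃} [Finite X] [Finite ι]
    [∀ i, Finite (S i)] (Γ : ∀ i, SimpleGraph (S i)) (s : ∀ i, S i) (w : ι → FreeGroup X)
    (hw : ∀ i, w i ≠ 1) {G : Type*} [Group G] (j : FreeGroup X →* G) (b : ∀ i, RAAG (Γ i) →* G)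
    (hjb : ∀ i, j (w i) = b i (PresentedGroup.of (s i)))
    (hgen : ∀ H : Subgroup G, (∀ f, j f ∈ H) → (∀ i x, b i x ∈ H) → H = ⊤)
    (huniv : ∀ (L : Type (max u₁ u₂ u₃)) [Group L] (j' : FreeGroup X →* L)
      (b' : ∀ i, RAAG (Γ i) →* L), (∀ i, j' (w i) = b' i (PresentedGroup.of (s i))) →
      ∃ Φ : G →* L, (∀ f, Φ (j f) = j' f) ∧ ∀ i x, Φ (b i x) = b' i x) :
    IsLinearOver ℤ G := by
  choose l hl a h hred hwh using fun i => FreeGroup.exists_conj_cycleWord (hw i)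
  choose ρ hρ using fun i => FreeGroup.exists_followsCycle (hred i)
  let π : FreeGroup X →* CyclePerms l := MonoidHom.pi ρ
  have hπ : ∀ i, FollowsCycle (a i)
      ((Pi.evalMonoidHom (fun i => Equiv.Perm (ZMod (l i))) i).comp π) := hρ
  obtain ⟨Φ, hΦj, hΦb⟩ := huniv (CoverGroup a Γ s) (coverFreeHom a Γ s π) (coverRAAGHom h hπ)
    fun i => by rw [coverRAAGHom_of_self, ← hwh]
  exact (isLinearOver_coverGroup a Γ s).of_injective Φ
    (injective_of_coverGroup hπ hred (fun i => by rw [← hwh, hjb]) hgen Φ hΦj hΦb)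

-- From the fundamental group of the star to the universal property.

/-- A finitely generated group has finitely many homomorphisms to `ℤ/2`, while a free group has one
for each function on its basis. -/
theorem FreeGroup.finite_of_fg {X : Type*} (h : Group.FG (FreeGroup X)) : Finite X := by
  classical
  obtain ⟨A, hA⟩ := Group.fg_def.mp h
  let M := Multiplicative (ZMod 2)
  have h1 : Finite (FreeGroup X →* M) := by
    refine Finite.of_injective (fun (f : FreeGroup X →* M) (x : A) => f x) fun f g hfg => ?_
    exact MonoidHom.eq_of_eqOn_dense hA fun x hx => congrFun hfg ⟨x, hx⟩
  have h2 : Finite (X → M) := Finite.of_equiv _ (FreeGroup.lift (β := M)).symm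
  have hne : Multiplicative.ofAdd (1 : ZMod 2) ≠ (1 : M) := by decide
  refine Finite.of_injective (fun x : X => (Pi.mulSingle x (Multiplicative.ofAdd 1) : X → M))
    fun x y hxy => ?_
  by_contra hxy'
  have := congrFun hxy x
  simp only [Pi.mulSingle_eq_same, Pi.mulSingle_eq_of_ne hxy'] at this
  exact hne this

/-- A path can enter `some i` only through the edge `i`. -/
theorem starGraph_isMaximalSubtree_mem {m : ℕ} {T : Set (Fin m)}
    (hT : (starGraph m).IsMaximalSubtree T) (i : Fin m) : i ∈ T := by
  obtain ⟨p, ⟨hp, -, hpT⟩, -⟩ := hT none (some i)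
  suffices h : ∀ (p : List (Fin m × Bool)) (u : Option (Fin m)), u ≠ some i →
      (starGraph m).IsPath u (some i) p → ∃ e ∈ p, e.1 = i by
    obtain ⟨e, he, rfl⟩ := h p none (by simp) hp
    exact hpT e he
  intro p
  induction p with
  | nil => intro u hu h; exact absurd h hu
  | cons e p ih =>
    rintro u hu ⟨-, h⟩
    by_cases he : e.1 = i
    · exact ⟨e, by simp, he⟩
    · obtain ⟨e', he', h'⟩ := ih _ (by
        rcases e with ⟨k, _ | _⟩
        · exact fun hk => Option.some_ne_none i hk.symm
        · exact fun hk => he (Option.some.inj hk)) h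
      exact ⟨e', by simp [he'], h'⟩

namespace GraphOfGroups

variable {V E : Type*} {Γ : GGraph V E} (𝒢 : GraphOfGroups Γ) (T : Set E)

/-- The projection to the fundamental group. -/
def toFundamentalGroup : 𝒢.BigFreeProduct →* 𝒢.FundamentalGroup T :=
  (QuotientGroup.mk' _).comp (QuotientGroup.mk' _)

/-- The homomorphism from a vertex group to the fundamental group. -/
def vertexHom (v : V) : 𝒢.vertexGroup v →* 𝒢.FundamentalGroup T :=
  (𝒢.toFundamentalGroup T).comp (Monoid.Coprod.inl.comp Monoid.CoprodI.of)

variable {T}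

theorem toFundamentalGroup_edgeElt {e : E × Bool} (he : e.1 ∈ T) :
    𝒢.toFundamentalGroup T (𝒢.edgeElt e) = 1 :=
  (QuotientGroup.eq_one_iff _).mpr (Subgroup.subset_normalClosure ⟨e, he, rfl⟩)

theorem toFundamentalGroup_pathRelator {r : 𝒢.BigFreeProduct} (hr : r ∈ 𝒢.pathRelators) :
    𝒢.toFundamentalGroup T r = 1 := by
  have : (QuotientGroup.mk' (Subgroup.normalClosure 𝒢.pathRelators)) r = 1 :=
    (QuotientGroup.eq_one_iff _).mpr (Subgroup.subset_normalClosure hr)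
  rw [toFundamentalGroup, MonoidHom.comp_apply, this, map_one]

theorem vertexHom_α {e : E × Bool} (he : e.1 ∈ T) (g : 𝒢.edgeGroup e.1) :
    𝒢.vertexHom T _ (𝒢.α e g) = 𝒢.vertexHom T _ (𝒢.ω e g) := by
  have h := 𝒢.toFundamentalGroup_pathRelator (T := T) (Or.inl ⟨e, g, rfl⟩)
  rw [map_mul, map_mul, map_mul, map_inv, map_inv, 𝒢.toFundamentalGroup_edgeElt he, one_mul,
    inv_one, mul_one] at h
  exact mul_inv_eq_one.mp h

theorem eq_top_of_vertexHom_mem (hT : ∀ e, e ∈ T) (H : Subgroup (𝒢.FundamentalGroup T))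
    (h : ∀ v g, 𝒢.vertexHom T v g ∈ H) : H = ⊤ := by
  have key : ∀ x, 𝒢.toFundamentalGroup T x ∈ H := fun x => by
    induction x using Monoid.Coprod.induction_on with
    | inl x =>
      induction x using Monoid.CoprodI.induction_on with
      | one => rw [map_one, map_one]; exact one_mem H
      | of v g => exact h v g
      | mul x y hx hy => rw [map_mul, map_mul]; exact mul_mem hx hy
    | inr x =>
      have : (𝒢.toFundamentalGroup T).comp Monoid.Coprod.inr = 1 :=
        FreeGroup.ext_hom _ _ fun e => 𝒢.toFundamentalGroup_edgeElt (hT e.1)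
      have := DFunLike.congr_fun this x
      rw [MonoidHom.comp_apply] at this
      rw [this]
      exact one_mem H
    | mul x y hx hy => rw [map_mul]; exact mul_mem hx hy
  refine (Subgroup.eq_top_iff' H).mpr fun x => ?_
  obtain ⟨x, rfl⟩ := QuotientGroup.mk'_surjective _ x
  obtain ⟨x, rfl⟩ := QuotientGroup.mk'_surjective _ x
  exact key x

variable (T) in
theorem exists_hom_of_vertexHoms {L : Type*} [Group L] (f : ∀ v, 𝒢.vertexGroup v →* L)
    (hf : ∀ (e : E × Bool) (g : 𝒢.edgeGroup e.1), f _ (𝒢.α e g) = f _ (𝒢.ω e g)) :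
    ∃ Φ : 𝒢.FundamentalGroup T →* L, ∀ v g, Φ (𝒢.vertexHom T v g) = f v g := by
  let F : 𝒢.BigFreeProduct →* L := Monoid.Coprod.lift (Monoid.CoprodI.lift f) 1
  have hv : ∀ v g, F (𝒢.vertexElt v g) = f v g := fun v g => by simp [F, vertexElt]
  have he : ∀ e, F (𝒢.edgeElt e) = 1 := fun e => by simp [F, edgeElt]
  let F' : 𝒢.PathGroup →* L := QuotientGroup.lift _ F <| by
    refine (Subgroup.normalClosure_le_normal (N := F.ker) ?_)
    rintro r (⟨e, g, rfl⟩ | ⟨e, rfl⟩)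
    · show F _ = 1
      simp only [map_mul, map_inv, hv, he, hf e g]
      group
    · show F _ = 1
      simp only [map_mul, he, mul_one]
  refine ⟨QuotientGroup.lift _ F' ?_, fun v g => hv v g⟩
  refine (Subgroup.normalClosure_le_normal (N := F'.ker) ?_)
  rintro _ ⟨e, -, rfl⟩
  exact he e

end GraphOfGroups

/-- In `S_m` the edge `(i, true)` runs from the center `none` to the external vertex `some i`. The
hypothesis `hω` contains that each external vertex group is a right-angled Artin group. -/
theorem mainTheorem11 (m : ℕ) (𝒢 : GraphOfGroups (starGraph m))
    (hfree : IsFreeGroup (𝒢.vertexGroup none)) (hfg : Group.FG (𝒢.vertexGroup none))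
    (k : ∀ i : Fin m, 𝒢.edgeGroup i)
    (hk : ∀ (i : Fin m) (x : 𝒢.edgeGroup i), x ∈ Subgroup.zpowers (k i))
    (hω : ∀ i : Fin m, ∃ S : Set (𝒢.vertexGroup (some i)),
      IsRAAGGeneratingSet S ∧ 𝒢.ω (i, true) (k i) ∈ S)
    (T : Set (Fin m)) (hT : (starGraph m).IsMaximalSubtree T) :
    IsLinearOver ℤ (𝒢.FundamentalGroup T) := by
  have hmem := starGraph_isMaximalSubtree_mem hT
  choose S hS hkS using hω
  choose Γ φ hφ using fun i => (hS i).2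
  have hfin : ∀ i, Finite (S i) := fun i => (hS i).1
  let ε : FreeGroup (IsFreeGroup.Generators (𝒢.vertexGroup none)) ≃* 𝒢.vertexGroup none :=
    IsFreeGroup.mulEquiv _
  have hX : Finite (IsFreeGroup.Generators (𝒢.vertexGroup none)) :=
    FreeGroup.finite_of_fg (Group.fg_of_surjective (f := ε.symm.toMonoidHom) ε.symm.surjective)
  let α : ∀ i, 𝒢.edgeGroup i →* 𝒢.vertexGroup none := fun i => 𝒢.α (i, true)
  let ω : ∀ i, 𝒢.edgeGroup i →* 𝒢.vertexGroup (some i) := fun i => 𝒢.ω (i, true)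
  have hαω : ∀ i g, 𝒢.vertexHom T none (α i g) = 𝒢.vertexHom T (some i) (ω i g) :=
    fun i g => 𝒢.vertexHom_α (e := (i, true)) (hmem i) g
  let s : ∀ i, S i := fun i => ⟨ω i (k i), hkS i⟩
  have hs : ∀ i, φ i (PresentedGroup.of (s i)) = ω i (k i) := fun i => hφ i (s i)
  refine isLinearOver_of_star Γ s (fun i => ε.symm (α i (k i))) (fun i hi => ?_)
    ((𝒢.vertexHom T none).comp ε.toMonoidHom)
    (fun i => (𝒢.vertexHom T (some i)).comp (φ i).toMonoidHom) (fun i => ?_) (fun H hH hH' => ?_)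
    fun L _ j' b' hL => ?_
  -- If the image of `k i` in the free group were trivial, injectivity of `α` would make `k i`
  -- trivial, but a standard generator of a RAAG is not.
  · have hk1 : k i = 1 := by
      refine 𝒢.α_injective (i, true) ?_
      rw [map_one]
      exact (MulEquiv.map_eq_one_iff _).mp hi
    refine RAAG.of_ne_one (Γ := Γ i) (s i) ((φ i).injective ?_)
    rw [hs, hk1, map_one, map_one]
  · simp [hs, hαω]
  · refine 𝒢.eq_top_of_vertexHom_mem hmem H ?_
    rintro (_ | i) g
    · simpa using hH (ε.symm g)
    · simpa using hH' i ((φ i).symm g)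
  · let f : ∀ v, 𝒢.vertexGroup v →* L
      | none => j'.comp ε.symm.toMonoidHom
      | some i => (b' i).comp (φ i).symm.toMonoidHom
    have hf : ∀ i g, f none (α i g) = f (some i) (ω i g) := fun i g => by
      -- Since `k i` generates the edge group, agreement on `k i` suffices.
      have hki : f none (α i (k i)) = f (some i) (ω i (k i)) := by
        show j' _ = b' i ((φ i).symm (ω i (k i)))
        rw [← hs, MulEquiv.symm_apply_apply]
        exact hL i
      obtain ⟨n, rfl⟩ := hk i g
      simp only [map_zpow, hki]
    obtain ⟨Φ, hΦ⟩ := 𝒢.exists_hom_of_vertexHoms T f (by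
      rintro ⟨i, _ | _⟩ g
      · exact (hf i g).symm
      · exact hf i g)
    refine ⟨Φ, fun x => ?_, fun i x => ?_⟩
    · show Φ (𝒢.vertexHom T none (ε x)) = _
      rw [hΦ]
      simp [f]
    · show Φ (𝒢.vertexHom T (some i) (φ i x)) = _
      rw [hΦ]
      simp [f]
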